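/- Let $\mathcal G$ be a finite connected graph with vertex set $V$ (loops and multiple edges are allowed). Consider a $\mathbb C^2$-bundle on $\mathcal G$, that is, a complex vector space $V_v$ with a fixed identification $V_v\cong\mathbb C^2$ for each vertex $v$, with an $\mathrm{SL}_2(\mathbb C)$-connection: for each edge $e$, oriented from $v$ to $v'$, an isomorphism $\phi_{e}:V_v\to V_{v'}$ whose matrix has determinant $1$; the isomorphism for the reversed orientation is $\phi_{e}^{-1}$. The bundle Laplacian $\Delta$ acts on sections $f\in\bigoplus_v V_v$ by \[ (\Delta f)(v)=\sum_{e:\,v'\to v}\bigl(f(v)-\phi_{e}f(v')\bigr), \] where the sum is over all oriented edges $e$ ending at $v$, and $v'$ is the initial vertex of $e$ (a loop at $v$ contributes once for each of its two orientations). View $\Delta$ as a $V\times V$ matrix with entries in $M_2(\mathbb C)$. A square matrix $M$ with entries in $M_2(\mathbb C)$ is self-dual if $M_{ij}$ is the adjugate of $M_{ji}$ for all $i,j$, and then its $Q$-determinant is \[ \operatorname{Qdet}(M)=\sum_{\sigma}\operatorname{sgn}(\sigma)\prod_{\text{cycles of }\sigma}\tfrac12\operatorname{tr}(w), \] where $\sigma$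 runs over all permutations of the index set, the product is over all cycles of $\sigma$ (fixed points included), and $w=M_{i\,\sigma(i)}M_{\sigma(i)\,\sigma^2(i)}\cdots$ is the product of the entries of $M$ along the cycle. A cycle-rooted spanning forest (CRSF) is a set $S$ of edges such that every vertex is an endpoint of some edge in $S$ and every connected component of $S$ has as many vertices as edges (hence contains exactly one cycle; a loop is a cycle of length $1$, and two parallel edges form a cycle of length $2$). Then $\Delta$ is self-dual, and \[ \operatorname{Qdet}\Delta=\sum_{\text{CRSFs } S}\ \prod_{\text{cycles } \gamma \text{ of } S}\bigl(2-\operatorname{tr}(w_\gamma)\bigr), \] where $w_\gamma$ is the monodromy of the connection around $\gamma$, i.e. the product of the parallel transports around $\gamma$ (its trace does not depend on the starting vertex or on the orientation of $\gamma$). -/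

import Mathlib

open scoped BigOperators

/-! ### Self-dual matrices over `M₂(ℂ)` and the `Q`-determinant -/

/-- The matrix `M` with entries in `M₂(ℂ)` is self-dual when `M i j` is the adjugate of `M j i`. -/
def IsSelfDual {V : Type*} (M : Matrix V V (Matrix (Fin 2) (Fin 2) ℂ)) : Prop :=
  ∀ i j, M i j = (M j i).adjugate

/-- The ordered product `M x (σ x) * M (σ x) (σ² x) * ⋯ * M (σ^(k-1) x) x` along the cycle of `σ`
through `x`, where `k` is the length of that cycle; it is `M x x` when `σ` fixes `x`. -/
noncomputable def permCycleProd {V : Type*} (M : Matrix V V (Matrix (Fin 2) (Fin 2) ℂ))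
    (σ : Equiv.Perm V) (x : V) : Matrix (Fin 2) (Fin 2) ℂ :=
  ((List.range (Function.minimalPeriod σ x)).map
    fun k => M ((σ ^ k) x) ((σ ^ (k + 1)) x)).prod

open Classical in
/-- The `Q`-determinant `∑ σ, sgn σ * ∏ (1/2) tr w`, where the inner product runs over all cycles of
`σ` (the orbits of `σ`, fixed points included) and `w` is the product of the entries of `M` along
the cycle. The trace does not depend on the point of the orbit at which the product starts. -/
noncomputable def qdet {V : Type*} [Fintype V]
    (M : Matrix V V (Matrix (Fin 2) (Fin 2) ℂ)) : ℂ :=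
  ∑ σ : Equiv.Perm V, ((Equiv.Perm.sign σ : ℤ) : ℂ) *
    ∏ c : Quotient (Equiv.Perm.SameCycle.setoid σ),
      (1 / 2 : ℂ) * (permCycleProd M σ c.out).trace

/-! ### Graphs -/

/-- An undirected graph on the vertex set `V` with edge set `E`; loops and multiple edges are
allowed. The edge `e` joins `src e` and `tgt e`; which end is the source is an arbitrary reference
orientation. -/
structure MultiGraph (V E : Type*) where
  src : E → V
  tgt : E → V

namespace MultiGraph

/-- Initial vertex of an oriented edge; `(e, true)` is `e` with its reference orientation and
`(e, false)` is `e` with the opposite orientation. -/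
def tail {V E : Type*} (G : MultiGraph V E) : E × Bool → V
  | (e, true) => G.src e
  | (e, false) => G.tgt e

/-- Terminal vertex of an oriented edge. -/
def head {V E : Type*} (G : MultiGraph V E) : E × Bool → V
  | (e, true) => G.tgt e
  | (e, false) => G.src e

/-- Walks, as sequences of composable oriented edges. -/
inductive Walk {V E : Type*} (G : MultiGraph V E) : V → V → Type _
  | nil (v : V) : Walk G v v
  | cons (d : E × Bool) {w : V} (p : Walk G (G.head d) w) : Walk G (G.tail d) w

/-- The list of edges of a walk. -/
def Walk.edges {V E : Type*} {G : MultiGraph V E} : {u w : V} → G.Walk u w → List E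
  | _, _, .nil _ => []
  | _, _, .cons d p => d.1 :: p.edges

/-- The list of initial vertices of the steps of a walk. -/
def Walk.tails {V E : Type*} {G : MultiGraph V E} : {u w : V} → G.Walk u w → List V
  | _, _, .nil _ => []
  | _, _, .cons d p => G.tail d :: p.tails

/-- A closed walk goes once around a cycle when it has at least one step, no repeated edge and no
repeated vertex (apart from its end, which is its start). -/
def Walk.IsCyclic {V E : Type*} {G : MultiGraph V E} {v : V} (p : G.Walk v v) : Prop :=
  p.edges ≠ [] ∧ p.edges.Nodup ∧ p.tails.Nodup

def Connected {V E : Type*} (G : MultiGraph V E) : Prop :=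
  Nonempty V ∧ ∀ u v, Nonempty (G.Walk u v)

/-- `u` and `v` lie in the same connected component of the subgraph with all vertices of `G` and
edge set `S`. -/
def ReachIn {V E : Type*} (G : MultiGraph V E) (S : Finset E) (u v : V) : Prop :=
  ∃ p : G.Walk u v, ∀ e ∈ p.edges, e ∈ S

/-- `S` is (the edge set of) a cycle-rooted spanning forest: every vertex is an end of an edge of
`S`, and every connected component of `S` has as many vertices as edges. -/
def IsCRSF {V E : Type*} (G : MultiGraph V E) (S : Finset E) : Prop :=
  (∀ v, ∃ e ∈ S, G.src e = v ∨ G.tgt e = v) ∧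
  ∀ v, Set.ncard {w | G.ReachIn S v w} = Set.ncard {e | e ∈ S ∧ G.ReachIn S v (G.src e)}

/-- `C` is (the edge set of) a cycle: the set of edges of a closed walk that goes once around a
cycle. A loop is a cycle of length one, two parallel edges form a cycle of length two. -/
def IsCycle {V E : Type*} (G : MultiGraph V E) (C : Finset E) : Prop :=
  ∃ (v : V) (p : G.Walk v v), p.IsCyclic ∧ ∀ e, e ∈ C ↔ e ∈ p.edges

open Classical in
/-- The set of all cycle-rooted spanning forests. -/
noncomputable def crsfs {V E : Type*} [Fintype E] (G : MultiGraph V E) : Finset (Finset E) :=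
  Finset.univ.filter fun S => G.IsCRSF S

open Classical in
/-- The set of all (unoriented) cycles contained in `S`. -/
noncomputable def cyclesIn {V E : Type*} (G : MultiGraph V E) (S : Finset E) :
    Finset (Finset E) :=
  S.powerset.filter fun C => G.IsCycle C

/-! ### Connections and the Laplacian -/

/-- A connection on the vector bundle with fibres `F v`: an isomorphism from the fibre at the
source to the fibre at the target of each edge; parallel transport in the opposite direction is the
inverse isomorphism. -/
structure Connection {V E : Type*} (G : MultiGraph V E) (F : V → Type*)
    [∀ v, AddCommGroup (F v)] [∀ v, Module ℂ (F v)] where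
  edgeTransport : ∀ e : E, F (G.src e) ≃ₗ[ℂ] F (G.tgt e)

namespace Connection

/-- Parallel transport along an oriented edge. -/
def transport {V E : Type*} {G : MultiGraph V E} {F : V → Type*}
    [∀ v, AddCommGroup (F v)] [∀ v, Module ℂ (F v)] (Φ : G.Connection F) :
    (d : E × Bool) → F (G.tail d) ≃ₗ[ℂ] F (G.head d)
  | (e, true) => Φ.edgeTransport e
  | (e, false) => (Φ.edgeTransport e).symm

/-- Parallel transport along a walk; for a closed walk this is the monodromy. -/
def walkTransport {V E : Type*} {G : MultiGraph V E} {F : V → Type*}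
    [∀ v, AddCommGroup (F v)] [∀ v, Module ℂ (F v)] (Φ : G.Connection F) :
    {u w : V} → G.Walk u w → (F u ≃ₗ[ℂ] F w)
  | _, _, .nil v => LinearEquiv.refl ℂ (F v)
  | _, _, .cons d p => (Φ.transport d).trans (Φ.walkTransport p)

open Classical in
/-- The trace of the monodromy of the cycle `C`, computed from some closed walk that goes once
around `C`. Changing the starting vertex replaces the monodromy by a conjugate and reversing the
orientation replaces it by its inverse, which has the same trace for an `SL₂(ℂ)` connection. (The
value is `0` if `C` is not a cycle.) -/
noncomputable def cycleTrace {V E : Type*} {G : MultiGraph V E} {F : V → Type*}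
    [∀ v, AddCommGroup (F v)] [∀ v, Module ℂ (F v)] (Φ : G.Connection F) (C : Finset E) : ℂ :=
  if h : G.IsCycle C then
    LinearMap.trace ℂ (F h.choose) (Φ.walkTransport h.choose_spec.choose).toLinearMap
  else 0

/-- The bundle Laplacian `(Δ f)(v) = ∑ (f v - φ_d (f v'))` on sections, the sum being over the
oriented edges `d` with terminal vertex `v`, and `v'` being the initial vertex of `d`. -/
noncomputable def laplacian {V E : Type*} [DecidableEq V] [Fintype E] {G : MultiGraph V E}
    {F : V → Type*} [∀ v, AddCommGroup (F v)] [∀ v, Module ℂ (F v)] (Φ : G.Connection F) :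
    (∀ v, F v) →ₗ[ℂ] (∀ v, F v) :=
  ∑ d : E × Bool, LinearMap.single ℂ F (G.head d) ∘ₗ
    (LinearMap.proj (G.head d) - (Φ.transport d).toLinearMap ∘ₗ LinearMap.proj (G.tail d))

/-- For a `ℂ²`-bundle, with each fibre identified with `ℂ²` by `frame`, the connection is an
`SL₂(ℂ)` connection when all parallel transports are given by matrices of determinant `1`. -/
def IsSL2 {V E : Type*} {G : MultiGraph V E} {F : V → Type*}
    [∀ v, AddCommGroup (F v)] [∀ v, Module ℂ (F v)] (Φ : G.Connection F)
    (frame : ∀ v, F v ≃ₗ[ℂ] (Fin 2 → ℂ)) : Prop :=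
  ∀ e, (LinearMap.toMatrix' ((frame (G.tgt e)).toLinearMap ∘ₗ
    (Φ.edgeTransport e).toLinearMap ∘ₗ (frame (G.src e)).symm.toLinearMap)).det = 1

end Connection

end MultiGraph

/-- The matrix, with entries in `M₂(ℂ)`, of a linear operator on the space of sections of a
`ℂ²`-bundle whose fibres are identified with `ℂ²` by `frame`. -/
noncomputable def blockMatrix {V : Type*} [DecidableEq V] {F : V → Type*}
    [∀ v, AddCommGroup (F v)] [∀ v, Module ℂ (F v)] (frame : ∀ v, F v ≃ₗ[ℂ] (Fin 2 → ℂ))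
    (T : (∀ v, F v) →ₗ[ℂ] (∀ v, F v)) : Matrix V V (Matrix (Fin 2) (Fin 2) ℂ) :=
  Matrix.of fun i j => LinearMap.toMatrix' ((frame i).toLinearMap ∘ₗ LinearMap.proj i ∘ₗ T ∘ₗ
    LinearMap.single ℂ F j ∘ₗ (frame j).symm.toLinearMap)

/-! The `Q`-determinant is multilinear in the rows: each permutation has exactly one cycle through a
given index, and that cycle uses the row once. Row `v` of the Laplacian is a sum over the oriented
edges `d` ending at `v`, each contributing the identity in column `v` minus the transport of `d` in
the column of its tail. Expanding gives a sum over choices `D` of one incoming oriented edge per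
vertex (`qdet_sum_rows`).

Such a choice defines the self-map `f v = tail (D v)`, and its term is the `Q`-determinant of `1 - W
• f`. A permutation contributes only if its nontrivial cycles are cycles of `f`. The sign of such a
cycle and the minus signs of its entries leave a single `-1`, so the term is the product of `1 -
tr(w)/2` over the cycles of `f` (`qdet_stepMatrix`).

If two vertices choose the same edge, `f` has a 2-cycle that backtracks. Its monodromy is `1` and
the term vanishes (`prod_mapCycles_eq_zero`). Otherwise `D` orients its set `S` of chosen edges. The
sets that arise are exactly the CRSFs: one inclusion is a count in each component
(`IsOrientation.isCRSF`), the other is Hall's theorem (`IsCRSF.exists_isOrientation`). The cycles of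
`f` are the cycles of `S`, with monodromy traces independent of direction because the transports lie
in `SL₂`. A CRSF with `k` cycles has `2 ^ k` orientations, one direction per cycle
(`IsOrientation.card_eq`), and `2 ^ k ∏ (1 - tr(w)/2) = ∏ (2 - tr(w))`. -/

/-! ### Multilinearity of the `Q`-determinant in the rows -/

theorem permCycleProd_update_of_not_sameCycle {V : Type*} [DecidableEq V]
    (M : V → V → Matrix (Fin 2) (Fin 2) ℂ) (σ : Equiv.Perm V) {i x : V}
    (h : ¬ σ.SameCycle x i) (r : V → Matrix (Fin 2) (Fin 2) ℂ) :
    permCycleProd (Matrix.of (Function.update M i r)) σ x = permCycleProd (Matrix.of M) σ x := by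
  unfold permCycleProd
  congr 1
  refine List.map_congr_left fun k _ => ?_
  have : (σ ^ k) x ≠ i := fun hk => h ⟨k, by simpa using hk⟩
  simp [Function.update_of_ne this]

/-- The cycle visits `i` exactly once, so row `i` supplies a single factor; `P` and `Q` collect the
factors before and after it. -/
theorem permCycleProd_update_of_sameCycle {V : Type*} [DecidableEq V] [Fintype V]
    (M : V → V → Matrix (Fin 2) (Fin 2) ℂ) (σ : Equiv.Perm V) {i x : V}
    (h : σ.SameCycle x i) :
    ∃ P Q : Matrix (Fin 2) (Fin 2) ℂ, ∀ r : V → Matrix (Fin 2) (Fin 2) ℂ,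
      permCycleProd (Matrix.of (Function.update M i r)) σ x = P * r (σ i) * Q := by
  obtain ⟨m₀, hm₀⟩ : ∃ m : ℕ, (σ ^ m) x = i := by
    obtain ⟨m, -, -, hm⟩ := h.exists_pow_eq'' 
    exact ⟨m, hm⟩
  have hper : x ∈ Function.periodicPts σ := σ.injective.mem_periodicPts x
  set n := Function.minimalPeriod σ x with hn
  have hnpos : 0 < n := Function.minimalPeriod_pos_of_mem_periodicPts hper
  -- Reducing modulo the period places the exponent among the indices of the product.
  set m := m₀ % n with hmdef
  have hm : (σ ^ m) x = i := by
    rw [← hm₀, ← Equiv.Perm.iterate_eq_pow, ← Equiv.Perm.iterate_eq_pow, hmdef, hn,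
      Function.iterate_mod_minimalPeriod_eq]
  have hmn : m < n := Nat.mod_lt _ hnpos
  have hne : ∀ k < n, k ≠ m → (σ ^ k) x ≠ i := by
    intro k hk hkm hki
    apply hkm
    rw [← hm, ← Equiv.Perm.iterate_eq_pow, ← Equiv.Perm.iterate_eq_pow] at hki
    exact Function.iterate_injOn_Iio_minimalPeriod hk hmn hki
  obtain ⟨l, hl⟩ : ∃ l, n = m + (1 + l) := ⟨n - m - 1, by omega⟩
  let g : ℕ → Matrix (Fin 2) (Fin 2) ℂ := fun k => M ((σ ^ k) x) ((σ ^ (k + 1)) x)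
  refine ⟨((List.range m).map g).prod,
    ((List.range l).map fun k => g (m + (1 + k))).prod, fun r => ?_⟩
  unfold permCycleProd
  rw [← hn, hl, List.range_add, List.range_add, List.range_one]
  simp only [List.map_append, List.map_map, List.prod_append, List.map_cons, List.map_nil,
    List.prod_cons, List.prod_nil]
  rw [mul_one, mul_assoc]
  congr 1
  · congr 1
    refine List.map_congr_left fun k hk => ?_
    have hk' := List.mem_range.1 hk
    simp [g, Function.update_of_ne (hne k (by omega) (by omega))]
  congr 1
  · simp [hm, pow_succ', ]
  · congr 1
    refine List.map_congr_left fun k hk => ?_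
    have hk' := List.mem_range.1 hk
    simp only [Function.comp_apply, Matrix.of_apply, g]
    rw [Function.update_of_ne (hne _ (by omega) (by omega))]

/-- Only the cycle through `i` sees row `i`. `L` is fixed before the `Fintype` instance, so that the
equation applies to the instance inside `qdet`. -/
theorem exists_linear_update_cycleProd {V : Type*} [DecidableEq V] [Fintype V]
    (M : V → V → Matrix (Fin 2) (Fin 2) ℂ) (σ : Equiv.Perm V) (i : V) :
    ∃ L : (V → Matrix (Fin 2) (Fin 2) ℂ) →ₗ[ℂ] ℂ,
      ∀ (_ : Fintype (Quotient (Equiv.Perm.SameCycle.setoid σ))) r,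
      ∏ c : Quotient (Equiv.Perm.SameCycle.setoid σ), (1 / 2 : ℂ) *
        (permCycleProd (Matrix.of (Function.update M i r)) σ c.out).trace = L r := by
  classical
  let I : Fintype (Quotient (Equiv.Perm.SameCycle.setoid σ)) := Fintype.ofFinite _
  let c₀ : Quotient (Equiv.Perm.SameCycle.setoid σ) := Quotient.mk _ i
  obtain ⟨P, Q, hPQ⟩ := permCycleProd_update_of_sameCycle M σ
    (show σ.SameCycle c₀.out i from Quotient.mk_out (s := Equiv.Perm.SameCycle.setoid σ) i)
  let K : ℂ := ∏ c ∈ Finset.univ.erase c₀, (1 / 2 : ℂ) *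
        (permCycleProd (Matrix.of M) σ c.out).trace
  refine ⟨(1 / 2 * K) • (Matrix.traceLinearMap (Fin 2) ℂ ℂ ∘ₗ LinearMap.mulRight ℂ Q ∘ₗ
    LinearMap.mulLeft ℂ P ∘ₗ LinearMap.proj (σ i)), fun J r => ?_⟩
  obtain rfl : J = I := Subsingleton.elim _ _
  rw [← Finset.mul_prod_erase _ _ (Finset.mem_univ c₀), hPQ]
  have : ∏ c ∈ Finset.univ.erase c₀, (1 / 2 : ℂ) *
        (permCycleProd (Matrix.of (Function.update M i r)) σ c.out).trace = K := by
    refine Finset.prod_congr rfl fun c hc => ?_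
    rw [permCycleProd_update_of_not_sameCycle]
    intro h
    apply Finset.ne_of_mem_erase hc
    rw [← c.out_eq]
    exact Quotient.sound h
  rw [this]
  simp
  ring

/-- The `Q`-determinant as a multilinear function of the rows. -/
noncomputable def qdetMultilinear (V : Type*) [Fintype V] :
    MultilinearMap ℂ (fun _ : V => V → Matrix (Fin 2) (Fin 2) ℂ) ℂ where
  toFun M := qdet (Matrix.of M)
  map_update_add' M i x y := by
    unfold qdet
    rw [← Finset.sum_add_distrib]
    refine Finset.sum_congr rfl fun σ _ => ?_
    obtain ⟨L, hL⟩ := exists_linear_update_cycleProd M σ i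
    rw [hL _, hL _, hL _, map_add, mul_add]
  map_update_smul' M i c x := by
    unfold qdet
    rw [smul_eq_mul, Finset.mul_sum]
    refine Finset.sum_congr rfl fun σ _ => ?_
    obtain ⟨L, hL⟩ := exists_linear_update_cycleProd M σ i
    rw [hL _, hL _, map_smul, smul_eq_mul]
    ring

theorem qdet_sum_rows {V ι : Type*} [Fintype V] [DecidableEq V] (A : V → Finset ι)
    (R : V → ι → V → Matrix (Fin 2) (Fin 2) ℂ) :
    qdet (Matrix.of fun i => ∑ d ∈ A i, R i d) =
      ∑ D ∈ Fintype.piFinset A, qdet (Matrix.of fun i => R i (D i)) :=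
  (qdetMultilinear V).map_sum_finset R A

/-! ### Cycles of a self-map -/

open Classical in
/-- The forward orbit of `x` under `f`. -/
noncomputable def forwardOrbit {V : Type*} [Fintype V] (f : V → V) (x : V) : Finset V :=
  Finset.univ.filter fun y => ∃ k : ℕ, f^[k] x = y

open Classical in
/-- The cycles of a self-map of a finite type, as sets of points. -/
noncomputable def mapCycles {V : Type*} [Fintype V] (f : V → V) : Finset (Finset V) :=
  (Finset.univ.filter (· ∈ Function.periodicPts f)).image (forwardOrbit f)

open Classical in
/-- The cyclic permutations of length at least two that agree with `f` on their support. -/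
noncomputable def permCycles {V : Type*} [Fintype V] (f : V → V) :
    Finset (Equiv.Perm V) :=
  Finset.univ.filter fun τ => τ.IsCycle ∧ ∀ a, τ a ≠ a → τ a = f a

theorem iterate_eq_perm_iterate {V : Type*} {f : V → V} {τ : Equiv.Perm V} (h : ∀ a, τ a ≠ a → τ a = f a) {x : V}
    (hx : τ x ≠ x) (k : ℕ) : f^[k] x = τ^[k] x := by
  induction k with
  | zero => rfl
  | succ k ih =>
    rw [Function.iterate_succ_apply', Function.iterate_succ_apply', ih, h]
    rw [Equiv.Perm.iterate_eq_pow]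
    rwa [Ne, ← Equiv.Perm.mul_apply, ← pow_succ', pow_succ, Equiv.Perm.mul_apply,
      EmbeddingLike.apply_eq_iff_eq]

/-- The product of `W` along the orbit of a periodic point `x` of `f`. -/
noncomputable def orbitProd {V R : Type*} [Monoid R] (f : V → V) (W : V → R) (x : V) : R :=
  ((List.range (Function.minimalPeriod f x)).map fun k => W (f^[k] x)).prod

theorem permCycleProd_eq_orbitProd {V : Type*} (M : Matrix V V (Matrix (Fin 2) (Fin 2) ℂ))
    (σ : Equiv.Perm V) (x : V) :
    permCycleProd M σ x = orbitProd σ (fun v => M v (σ v)) x := by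
  simp [permCycleProd, orbitProd, Equiv.Perm.iterate_eq_pow, pow_succ']

/-- Moving the starting point one step rotates the product, and the trace is cyclic. -/
theorem trace_orbitProd_apply {V : Type*} (f : V → V) (W : V → Matrix (Fin 2) (Fin 2) ℂ) {x : V}
    (hx : x ∈ Function.periodicPts f) :
    (orbitProd f W (f x)).trace = (orbitProd f W x).trace := by
  unfold orbitProd
  rw [Function.minimalPeriod_apply hx]
  have hp := Function.minimalPeriod_pos_of_mem_periodicPts hx
  have hfix : f^[Function.minimalPeriod f x] x = x := Function.iterate_minimalPeriod
  obtain ⟨n, hn⟩ : ∃ n, Function.minimalPeriod f x = n + 1 :=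
    ⟨Function.minimalPeriod f x - 1, by omega⟩
  rw [hn] at hfix ⊢
  conv_lhs => rw [List.range_succ]
  conv_rhs => rw [List.range_succ_eq_map]
  simp only [List.map_append, List.prod_append, List.map_cons, List.map_nil, List.prod_cons,
    List.prod_nil, mul_one, List.map_map, Function.iterate_zero, id]
  rw [Matrix.trace_mul_comm, ← Function.iterate_succ_apply, hfix]
  rfl

section

variable {V : Type*} [Fintype V] {f : V → V}

theorem mem_forwardOrbit {x y : V} : y ∈ forwardOrbit f x ↔ ∃ k : ℕ, f^[k] x = y := by
  simp [forwardOrbit]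

theorem self_mem_forwardOrbit (x : V) : x ∈ forwardOrbit f x := mem_forwardOrbit.2 ⟨0, rfl⟩

theorem mem_mapCycles {Z : Finset V} :
    Z ∈ mapCycles f ↔ ∃ x ∈ Function.periodicPts f, forwardOrbit f x = Z := by
  simp [mapCycles]

theorem forwardOrbit_eq_singleton {x : V} (h : f x = x) : forwardOrbit f x = {x} := by
  ext y
  rw [mem_forwardOrbit, Finset.mem_singleton]
  constructor
  · rintro ⟨k, rfl⟩
    exact Function.iterate_fixed h k
  · rintro rfl
    exact ⟨0, rfl⟩

theorem mem_periodicPts_of_mem_forwardOrbit {x y : V} (hx : x ∈ Function.periodicPts f)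
    (hy : y ∈ forwardOrbit f x) : y ∈ Function.periodicPts f := by
  obtain ⟨k, rfl⟩ := mem_forwardOrbit.1 hy
  exact (Function.bijOn_periodicPts f).mapsTo.iterate k hx

theorem forwardOrbit_eq_of_mem {x y : V} (hx : x ∈ Function.periodicPts f)
    (hy : y ∈ forwardOrbit f x) : forwardOrbit f y = forwardOrbit f x := by
  obtain ⟨k, rfl⟩ := mem_forwardOrbit.1 hy
  obtain ⟨n, hn, hp⟩ := hx
  ext z
  rw [mem_forwardOrbit, mem_forwardOrbit]
  constructor
  · rintro ⟨j, rfl⟩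
    exact ⟨j + k, Function.iterate_add_apply f j k x⟩
  · rintro ⟨j, rfl⟩
    -- After the `k` steps from `x`, another `(n - 1) * k` complete a multiple of the period `n`,
    -- returning to `x`.
    refine ⟨j + (n - 1) * k, ?_⟩
    rw [← Function.iterate_add_apply, add_assoc]
    have : (n - 1) * k + k = k * n := by
      obtain ⟨m, rfl⟩ : ∃ m, n = m + 1 := ⟨n - 1, by omega⟩
      simp; ring
    rw [this, Function.iterate_add_apply, (hp.const_mul k).eq]

theorem mem_permCycles {τ : Equiv.Perm V} :
    τ ∈ permCycles f ↔ τ.IsCycle ∧ ∀ a, τ a ≠ a → τ a = f a := by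
  simp [permCycles]

theorem forwardOrbit_eq_support [DecidableEq V] {τ : Equiv.Perm V} (hτ : τ ∈ permCycles f) {x : V}
    (hx : τ x ≠ x) : forwardOrbit f x = τ.support := by
  rw [mem_permCycles] at hτ
  ext y
  rw [mem_forwardOrbit, Equiv.Perm.mem_support]
  constructor
  · rintro ⟨k, rfl⟩
    rw [iterate_eq_perm_iterate hτ.2 hx, Equiv.Perm.iterate_eq_pow]
    rwa [Ne, ← Equiv.Perm.mul_apply, ← pow_succ', pow_succ, Equiv.Perm.mul_apply,
      EmbeddingLike.apply_eq_iff_eq]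
  · intro hy
    obtain ⟨k, hk⟩ := hτ.1.exists_pow_eq hx hy
    exact ⟨k, by rw [iterate_eq_perm_iterate hτ.2 hx, Equiv.Perm.iterate_eq_pow, hk]⟩

theorem mem_periodicPts_of_permCycles {τ : Equiv.Perm V} (hτ : τ ∈ permCycles f) {x : V}
    (hx : τ x ≠ x) : x ∈ Function.periodicPts f := by
  rw [mem_permCycles] at hτ
  obtain ⟨n, hn, hp⟩ := τ.injective.mem_periodicPts x
  exact ⟨n, hn, by
    rw [Function.IsPeriodicPt, Function.IsFixedPt, iterate_eq_perm_iterate hτ.2 hx]; exact hp⟩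

/-- A self-map permutes its periodic points. Extended by the identity this is a permutation, whose
cycle through `x` is the one sought. -/
theorem exists_permCycles [DecidableEq V] {x : V} (hx : x ∈ Function.periodicPts f) (hfx : f x ≠ x) :
    ∃ τ ∈ permCycles f, τ.support = forwardOrbit f x := by
  classical
  let p : V → V := fun v => if v ∈ Function.periodicPts f then f v else v
  have hmaps := (Function.bijOn_periodicPts f).mapsTo
  have hinj : Function.Injective p := by
    intro a b hab
    simp only [p] at hab
    split_ifs at hab with ha hb hb
    · exact (Function.bijOn_periodicPts f).injOn ha hb hab
    · exact absurd (hab ▸ hmaps ha) hb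
    · exact absurd (hab ▸ hmaps hb) ha
    · exact hab
  let π : Equiv.Perm V := Equiv.ofBijective p (Finite.injective_iff_bijective.1 hinj)
  have hπ : ∀ v, π v = if v ∈ Function.periodicPts f then f v else v := fun v => rfl
  have hx' : π x ≠ x := by rw [hπ, if_pos hx]; exact hfx
  have hmem : π.cycleOf x ∈ permCycles f := by
    refine mem_permCycles.2 ⟨Equiv.Perm.isCycle_cycleOf π hx', fun a ha => ?_⟩
    rw [Equiv.Perm.cycleOf_apply] at ha ⊢
    split_ifs at ha ⊢ with h
    · rw [hπ] at ha ⊢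
      split_ifs at ha ⊢
      · rfl
      · exact absurd rfl ha
    · exact absurd rfl ha
  exact ⟨_, hmem, (forwardOrbit_eq_support hmem (by rwa [Equiv.Perm.cycleOf_apply_self])).symm⟩

/-- Longer cycles correspond to cyclic permutations through their supports; fixed points are
separate because the cycle factors of a permutation omit them. -/
theorem prod_mapCycles [DecidableEq V] (f : V → V) (H : Finset V → ℂ) :
    ∏ Z ∈ mapCycles f, H Z =
      (∏ τ ∈ permCycles f, H τ.support) * ∏ v ∈ Finset.univ.filter (fun v => f v = v), H {v} := by
  have hsplit : mapCycles f = (permCycles f).image Equiv.Perm.support ∪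
      (Finset.univ.filter (fun v => f v = v)).image singleton := by
    ext Z
    simp only [mem_mapCycles, Finset.mem_union, Finset.mem_image, Finset.mem_filter,
      Finset.mem_univ, true_and]
    constructor
    · rintro ⟨x, hx, rfl⟩
      by_cases hfx : f x = x
      · exact Or.inr ⟨x, hfx, (forwardOrbit_eq_singleton hfx).symm⟩
      · exact Or.inl (exists_permCycles hx hfx)
    · rintro (⟨τ, hτ, rfl⟩ | ⟨v, hv, rfl⟩)
      · obtain ⟨x, hx, -⟩ := (mem_permCycles.1 hτ).1
        exact ⟨x, mem_periodicPts_of_permCycles hτ hx, forwardOrbit_eq_support hτ hx⟩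
      · exact ⟨v, ⟨1, one_pos, hv⟩, forwardOrbit_eq_singleton hv⟩
  have hdisj : Disjoint ((permCycles f).image Equiv.Perm.support)
      ((Finset.univ.filter (fun v => f v = v)).image singleton) := by
    rw [Finset.disjoint_left]
    intro Z hZ hZ'
    obtain ⟨τ, hτ, rfl⟩ := Finset.mem_image.1 hZ
    obtain ⟨v, -, hv⟩ := Finset.mem_image.1 hZ'
    have := (mem_permCycles.1 hτ).1.two_le_card_support
    rw [← hv] at this
    simp at this
  rw [hsplit, Finset.prod_union hdisj, Finset.prod_image, Finset.prod_image]
  · intro a _ b _ h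
    exact Finset.singleton_injective h
  · intro τ hτ ρ hρ h
    have hτ' := mem_permCycles.1 hτ
    have hρ' := mem_permCycles.1 hρ
    ext a
    by_cases ha : a ∈ τ.support
    · rw [hτ'.2 a (Equiv.Perm.mem_support.1 ha), hρ'.2 a (Equiv.Perm.mem_support.1 (h ▸ ha))]
    · have hb : a ∉ ρ.support := h ▸ ha
      rw [Equiv.Perm.notMem_support.1 ha, Equiv.Perm.notMem_support.1 hb]

theorem permCycles_perm [DecidableEq V] (σ : Equiv.Perm V) : permCycles σ = σ.cycleFactorsFinset := by
  ext τ
  simp [mem_permCycles, Equiv.Perm.mem_cycleFactorsFinset_iff]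

theorem mem_forwardOrbit_perm (σ : Equiv.Perm V) {x y : V} :
    y ∈ forwardOrbit σ x ↔ σ.SameCycle x y := by
  rw [mem_forwardOrbit]
  constructor
  · rintro ⟨k, rfl⟩
    exact ⟨k, by simp [Equiv.Perm.iterate_eq_pow]⟩
  · intro h
    obtain ⟨k, -, -, hk⟩ := h.exists_pow_eq''
    exact ⟨k, by rw [Equiv.Perm.iterate_eq_pow, hk]⟩

theorem prod_quotient_sameCycle (σ : Equiv.Perm V)
    [Fintype (Quotient (Equiv.Perm.SameCycle.setoid σ))] (H : Finset V → ℂ) :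
    ∏ c : Quotient (Equiv.Perm.SameCycle.setoid σ), H (forwardOrbit σ c.out) =
      ∏ Z ∈ mapCycles σ, H Z := by
  classical
  have : mapCycles σ = Finset.univ.image
      fun c : Quotient (Equiv.Perm.SameCycle.setoid σ) => forwardOrbit σ c.out := by
    ext Z
    simp only [mem_mapCycles, Finset.mem_image, Finset.mem_univ, true_and]
    constructor
    · rintro ⟨x, hx, rfl⟩
      refine ⟨Quotient.mk _ x, forwardOrbit_eq_of_mem hx ((mem_forwardOrbit_perm σ).2 ?_)⟩
      exact (show σ.SameCycle _ x from
        Quotient.mk_out (s := Equiv.Perm.SameCycle.setoid σ) x).symm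
    · rintro ⟨c, rfl⟩
      exact ⟨_, σ.injective.mem_periodicPts _, rfl⟩
  rw [this, Finset.prod_image]
  intro c _ d _ h
  rw [← c.out_eq, ← d.out_eq]
  refine Quotient.sound ((mem_forwardOrbit_perm σ).1 ?_)
  have h' : forwardOrbit σ c.out = forwardOrbit σ d.out := h
  rw [h']
  exact self_mem_forwardOrbit _

theorem trace_orbitProd_eq_of_mem (W : V → Matrix (Fin 2) (Fin 2) ℂ) {x y : V}
    (hx : x ∈ Function.periodicPts f) (hy : y ∈ forwardOrbit f x) :
    (orbitProd f W y).trace = (orbitProd f W x).trace := by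
  obtain ⟨k, rfl⟩ := mem_forwardOrbit.1 hy
  clear hy
  induction k with
  | zero => rfl
  | succ k ih =>
    rw [Function.iterate_succ_apply', trace_orbitProd_apply, ih]
    exact (Function.bijOn_periodicPts f).mapsTo.iterate k hx

open Classical in
/-- Half the trace of the product of `W` along the cycle `Z` of `f`, starting at some point. -/
noncomputable def halfTrace (f : V → V) (W : V → Matrix (Fin 2) (Fin 2) ℂ) (Z : Finset V) : ℂ :=
  if h : Z.Nonempty then (1 / 2 : ℂ) * (orbitProd f W h.choose).trace else 0

theorem halfTrace_forwardOrbit (W : V → Matrix (Fin 2) (Fin 2) ℂ) {x : V}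
    (hx : x ∈ Function.periodicPts f) :
    halfTrace f W (forwardOrbit f x) = (1 / 2 : ℂ) * (orbitProd f W x).trace := by
  have h : (forwardOrbit f x).Nonempty := ⟨x, self_mem_forwardOrbit x⟩
  rw [halfTrace, dif_pos h, trace_orbitProd_eq_of_mem W hx h.choose_spec]

theorem halfTrace_support [DecidableEq V] (W : V → Matrix (Fin 2) (Fin 2) ℂ) {τ : Equiv.Perm V}
    (hτ : τ ∈ permCycles f) {x : V} (hx : τ x ≠ x) :
    halfTrace f W τ.support = (1 / 2 : ℂ) * (orbitProd f W x).trace := by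
  rw [← forwardOrbit_eq_support hτ hx, halfTrace_forwardOrbit W
    (mem_periodicPts_of_permCycles hτ hx)]

theorem halfTrace_singleton (W : V → Matrix (Fin 2) (Fin 2) ℂ) {v : V} (hv : f v = v) :
    halfTrace f W {v} = (1 / 2 : ℂ) * (W v).trace := by
  rw [← forwardOrbit_eq_singleton hv, halfTrace_forwardOrbit W ⟨1, one_pos, hv⟩, orbitProd,
    Function.minimalPeriod_eq_one_iff_isFixedPt.2 hv]
  simp

end

/-! ### The `Q`-determinant of a self-map with weights -/

open Classical in
theorem qdet_eq_sum_cycleFactorsFinset {V : Type*} [Fintype V] (M : Matrix V V (Matrix (Fin 2) (Fin 2) ℂ)) :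
    qdet M = ∑ σ : Equiv.Perm V, ((Equiv.Perm.sign σ : ℤ) : ℂ) *
      ((∏ τ ∈ σ.cycleFactorsFinset, halfTrace σ (fun v => M v (σ v)) τ.support) *
        ∏ v ∈ Finset.univ.filter (fun v => σ v = v), (1 / 2 : ℂ) * (M v v).trace) := by
  unfold qdet
  refine Finset.sum_congr rfl fun σ _ => ?_
  congr 1
  have h : ∀ c : Quotient (Equiv.Perm.SameCycle.setoid σ),
      (1 / 2 : ℂ) * (permCycleProd M σ c.out).trace =
        halfTrace σ (fun v => M v (σ v)) (forwardOrbit σ c.out) := fun c => by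
    rw [halfTrace_forwardOrbit _ (σ.injective.mem_periodicPts _), permCycleProd_eq_orbitProd]
  simp_rw [h]
  rw [prod_quotient_sameCycle, prod_mapCycles, permCycles_perm]
  congr 1
  refine Finset.prod_congr rfl fun v hv => ?_
  have hv' : σ v = v := (Finset.mem_filter.1 hv).2
  rw [halfTrace_singleton _ hv', hv']

theorem List.prod_map_neg_eq {ι R : Type*} [Ring R] (l : List ι) (g : ι → R) :
    (l.map fun i => -g i).prod = (-1) ^ l.length * (l.map g).prod := by
  induction l with
  | nil => simp
  | cons a l ih =>
    rw [List.map_cons, List.prod_cons, ih, List.map_cons, List.prod_cons, List.length_cons, pow_succ]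
    rcases neg_one_pow_eq_or R l.length with h | h <;> simp [h]

theorem minimalPeriod_congr {V : Type*} {f g : V → V} {x : V} (h : ∀ k : ℕ, f^[k] x = g^[k] x) :
    Function.minimalPeriod f x = Function.minimalPeriod g x := by
  apply Function.minimalPeriod_eq_minimalPeriod_iff.2
  intro n
  rw [Function.IsPeriodicPt, Function.IsFixedPt, h, Function.IsPeriodicPt, Function.IsFixedPt]

theorem card_support_eq_minimalPeriod {V : Type*} [Fintype V] [DecidableEq V] {f : V → V}
    {τ : Equiv.Perm V} (hτ : τ ∈ permCycles f) {x : V} (hx : τ x ≠ x) :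
    τ.support.card = Function.minimalPeriod f x := by
  rw [minimalPeriod_congr (iterate_eq_perm_iterate (mem_permCycles.1 hτ).2 hx),
    ← (mem_permCycles.1 hτ).1.orderOf]
  apply Nat.dvd_antisymm
  · rw [orderOf_dvd_iff_pow_eq_one, (mem_permCycles.1 hτ).1.pow_eq_one_iff]
    exact ⟨x, hx, by rw [← Equiv.Perm.iterate_eq_pow]; exact Function.iterate_minimalPeriod⟩
  · rw [← Function.isPeriodicPt_iff_minimalPeriod_dvd, Function.IsPeriodicPt, Function.IsFixedPt,
      Equiv.Perm.iterate_eq_pow, pow_orderOf_eq_one, Equiv.Perm.one_apply]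

/-- The matrix `1 - W • f`, whose row `i` is supported at the columns `i` and `f i`. -/
def stepMatrix {V : Type*} [DecidableEq V] (f : V → V) (W : V → Matrix (Fin 2) (Fin 2) ℂ) :
    Matrix V V (Matrix (Fin 2) (Fin 2) ℂ) :=
  Matrix.of fun i j => (if i = j then 1 else 0) - (if f i = j then W i else 0)

theorem stepMatrix_apply_of_ne {V : Type*} [DecidableEq V] (f : V → V)
    (W : V → Matrix (Fin 2) (Fin 2) ℂ) {i j : V} (hij : j ≠ i) :
    stepMatrix f W i j = if f i = j then -W i else 0 := by
  rw [stepMatrix, Matrix.of_apply, if_neg (Ne.symm hij)]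
  split_ifs <;> simp

section

variable {V : Type*} [Fintype V] [DecidableEq V] (f : V → V) (W : V → Matrix (Fin 2) (Fin 2) ℂ)

theorem half_trace_stepMatrix_self (v : V) : (1 / 2 : ℂ) * (stepMatrix f W v v).trace =
    if f v = v then 1 - halfTrace f W {v} else 1 := by
  rw [stepMatrix, Matrix.of_apply, if_pos rfl]
  split_ifs with h
  · rw [halfTrace_singleton _ h, Matrix.trace_sub]
    simp; ring
  · simp

/-- A cycle of length `n` has sign `-(-1) ^ n`, and its `n` entries `-W` contribute `(-1) ^ n`; one
minus sign remains. -/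
theorem halfTrace_stepMatrix {σ τ : Equiv.Perm V} (hτσ : τ ∈ σ.cycleFactorsFinset)
    (hτ : τ ∈ permCycles f) :
    ((Equiv.Perm.sign τ : ℤ) : ℂ) * halfTrace σ (fun v => stepMatrix f W v (σ v)) τ.support =
      -halfTrace f W τ.support := by
  obtain ⟨x, hx, -⟩ := (mem_permCycles.1 hτ).1
  rw [← permCycles_perm] at hτσ
  rw [halfTrace_support _ hτ hx, halfTrace_support _ hτσ hx, (mem_permCycles.1 hτ).1.sign,
    card_support_eq_minimalPeriod hτ hx]
  have h1 := iterate_eq_perm_iterate (mem_permCycles.1 hτ).2 hx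
  have h2 := iterate_eq_perm_iterate (mem_permCycles.1 hτσ).2 hx
  have h3 : orbitProd σ (fun v => stepMatrix f W v (σ v)) x =
      (-1) ^ (Function.minimalPeriod f x) * orbitProd f W x := by
    unfold orbitProd
    rw [minimalPeriod_congr (f := f) (g := σ) fun k => by rw [h1, h2]]
    have hneg := List.prod_map_neg_eq (List.range (Function.minimalPeriod σ x))
      fun k => W (f^[k] x)
    rw [List.length_range] at hneg
    rw [← hneg]
    congr 1
    refine List.map_congr_left fun k _ => ?_
    have hk : τ (τ^[k] x) ≠ τ^[k] x := by
      rw [Equiv.Perm.iterate_eq_pow]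
      rwa [Ne, ← Equiv.Perm.mul_apply, ← pow_succ', pow_succ, Equiv.Perm.mul_apply,
        EmbeddingLike.apply_eq_iff_eq]
    have hs : σ (τ^[k] x) = τ (τ^[k] x) := ((mem_permCycles.1 hτσ).2 _ hk).symm
    have hf : f (τ^[k] x) = τ (τ^[k] x) := ((mem_permCycles.1 hτ).2 _ hk).symm
    rw [h2, h1]
    change stepMatrix f W (τ^[k] x) (σ (τ^[k] x)) = _
    rw [hs, stepMatrix_apply_of_ne _ _ hk, if_pos hf]
  rw [h3]
  rcases neg_one_pow_eq_or (Matrix (Fin 2) (Fin 2) ℂ) (Function.minimalPeriod f x) with h | h <;>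
  rcases Nat.even_or_odd (Function.minimalPeriod f x) with h' | h' <;>
  simp [h'.neg_one_pow]

/-- A nontrivial cycle that departs from `f` somewhere picks up an off-diagonal entry outside column
`f x`, which is zero. -/
theorem prod_halfTrace_stepMatrix_eq_zero {σ : Equiv.Perm V}
    (h : ¬ σ.cycleFactorsFinset ⊆ permCycles f) :
    ∏ τ ∈ σ.cycleFactorsFinset, halfTrace σ (fun v => stepMatrix f W v (σ v)) τ.support = 0 := by
  obtain ⟨τ, hτ, hτf⟩ := Finset.not_subset.1 h
  refine Finset.prod_eq_zero hτ ?_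
  rw [← permCycles_perm] at hτ
  have hc := mem_permCycles.1 hτ
  obtain ⟨x, hx, hxf⟩ : ∃ x, τ x ≠ x ∧ τ x ≠ f x := by
    by_contra! hcon
    exact hτf (mem_permCycles.2 ⟨hc.1, hcon⟩)
  rw [halfTrace_support _ hτ hx, orbitProd]
  have hp := Function.minimalPeriod_pos_of_mem_periodicPts (σ.injective.mem_periodicPts x)
  have h0 : stepMatrix f W x (σ x) = 0 := by
    rw [← hc.2 x hx, stepMatrix_apply_of_ne _ _ hx, if_neg (Ne.symm hxf)]
  rw [List.prod_eq_zero (List.mem_map.2 ⟨0, List.mem_range.2 hp, h0⟩)]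
  simp

/-- If two of these cycles move a common point, both are the `f`-orbit of that point with the action
of `f`. -/
theorem permCycles_pairwise_disjoint :
    (permCycles f : Set (Equiv.Perm V)).Pairwise Equiv.Perm.Disjoint := by
  intro τ hτ ρ hρ hne
  rw [Equiv.Perm.disjoint_iff_disjoint_support, Finset.disjoint_left]
  intro x hx hx'
  apply hne
  rw [Equiv.Perm.mem_support] at hx hx'
  have hs : τ.support = ρ.support := by
    rw [← forwardOrbit_eq_support hτ hx, ← forwardOrbit_eq_support hρ hx']
  ext a
  by_cases ha : a ∈ τ.support
  · rw [(mem_permCycles.1 hτ).2 a (Equiv.Perm.mem_support.1 ha),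
      (mem_permCycles.1 hρ).2 a (Equiv.Perm.mem_support.1 (hs ▸ ha))]
  · have hb : a ∉ ρ.support := hs ▸ ha
    rw [Equiv.Perm.notMem_support.1 ha, Equiv.Perm.notMem_support.1 hb]

theorem sign_eq_prod_cycleFactorsFinset (σ : Equiv.Perm V) :
    ((Equiv.Perm.sign σ : ℤ) : ℂ) =
      ∏ τ ∈ σ.cycleFactorsFinset, ((Equiv.Perm.sign τ : ℤ) : ℂ) := by
  conv_lhs => rw [← σ.cycleFactorsFinset_noncommProd, Finset.map_noncommProd,
    Finset.noncommProd_eq_prod]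
  push_cast
  rfl

/-- The contributing permutations correspond to sets of longer cycles of `f`, and summing over these
sets expands `∏ (1 - h)`. Every point off the chosen cycles contributes its diagonal entry: `1`, or
`1 - h` if `f` fixes it. -/
theorem qdet_stepMatrix :
    qdet (stepMatrix f W) = ∏ Z ∈ mapCycles f, (1 - halfTrace f W Z) := by
  classical
  set K : ℂ := ∏ v ∈ Finset.univ.filter (fun v => f v = v), (1 - halfTrace f W {v}) with hK
  have hterm : ∀ σ : Equiv.Perm V, ((Equiv.Perm.sign σ : ℤ) : ℂ) *
      ((∏ τ ∈ σ.cycleFactorsFinset, halfTrace σ (fun v => stepMatrix f W v (σ v)) τ.support) *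
        ∏ v ∈ Finset.univ.filter (fun v => σ v = v), (1 / 2 : ℂ) * (stepMatrix f W v v).trace) =
      if σ.cycleFactorsFinset ⊆ permCycles f then
        (∏ τ ∈ σ.cycleFactorsFinset, -halfTrace f W τ.support) * K else 0 := by
    intro σ
    split_ifs with h
    · rw [sign_eq_prod_cycleFactorsFinset, ← mul_assoc, ← Finset.prod_mul_distrib]
      congr 1
      · exact Finset.prod_congr rfl fun τ hτ => halfTrace_stepMatrix f W hτ (h hτ)
      · simp_rw [half_trace_stepMatrix_self]
        rw [← Finset.prod_filter, Finset.filter_filter]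
        refine Finset.prod_congr ?_ fun _ _ => rfl
        ext v
        simp only [Finset.mem_filter, Finset.mem_univ, true_and, and_iff_right_iff_imp]
        -- A fixed point of `f` cannot lie on a nontrivial cycle of `σ`, since `σ` agrees with `f`
        -- there. Hence the factor `K` is the same for all contributing `σ`.
        intro hv
        by_contra hσ
        have hm : σ.cycleOf v ∈ σ.cycleFactorsFinset :=
          Equiv.Perm.cycleOf_mem_cycleFactorsFinset_iff.2 (Equiv.Perm.mem_support.2 hσ)
        have := (mem_permCycles.1 (h hm)).2 v (by rwa [Equiv.Perm.cycleOf_apply_self])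
        rw [Equiv.Perm.cycleOf_apply_self, hv] at this
        exact hσ this
    · rw [prod_halfTrace_stepMatrix_eq_zero f W h]
      simp
  have hsum : qdet (stepMatrix f W) = ∑ σ : Equiv.Perm V, ((Equiv.Perm.sign σ : ℤ) : ℂ) *
      ((∏ τ ∈ σ.cycleFactorsFinset, halfTrace σ (fun v => stepMatrix f W v (σ v)) τ.support) *
        ∏ v ∈ Finset.univ.filter (fun v => σ v = v), (1 / 2 : ℂ) * (stepMatrix f W v v).trace) := by
    convert qdet_eq_sum_cycleFactorsFinset (stepMatrix f W)
  rw [hsum, Finset.sum_congr rfl fun σ _ => hterm σ, ← Finset.sum_filter,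
    ← Finset.sum_mul, prod_mapCycles, ← hK]
  congr 1
  rw [Finset.prod_congr rfl fun τ _ => sub_eq_neg_add (1 : ℂ) (halfTrace f W τ.support),
    Finset.prod_add_one]
  refine Finset.sum_bij (fun σ _ => σ.cycleFactorsFinset) ?_ ?_ ?_ ?_
  · intro σ hσ
    exact Finset.mem_powerset.2 (Finset.mem_filter.1 hσ).2
  · intro σ _ ρ _ h
    exact Equiv.Perm.cycleFactorsFinset_injective h
  · intro T hT
    rw [Finset.mem_powerset] at hT
    have hd : (T : Set (Equiv.Perm V)).Pairwise Equiv.Perm.Disjoint :=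
      (permCycles_pairwise_disjoint f).mono (by exact_mod_cast hT)
    -- Any set of the cycles is pairwise disjoint, so its product is a permutation with precisely
    -- these cycle factors.
    have hσ : (T.noncommProd id (hd.imp fun _ _ => Equiv.Perm.Disjoint.commute)).cycleFactorsFinset
        = T := Equiv.Perm.cycleFactorsFinset_eq_finset.2
      ⟨fun τ hτ => (mem_permCycles.1 (hT hτ)).1, hd, rfl⟩
    exact ⟨_, Finset.mem_filter.2 ⟨Finset.mem_univ _, by rw [hσ]; exact hT⟩, hσ⟩
  · intro σ _
    rfl

end

/-! ### Subsets that a self-map carries onto themselves -/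

theorem mem_periodicPts_of_image_eq {V : Type*} [DecidableEq V] {f : V → V}
    {X : Finset V} (h : X.image f = X) {x : V} (hx : x ∈ X) : x ∈ Function.periodicPts f := by
  have hm : ∀ y : X, f y ∈ X := fun y => by
    have := Finset.mem_image_of_mem f y.2
    rwa [h] at this
  let g : X → X := fun y => ⟨f y, hm y⟩
  have hg : Function.Surjective g := by
    rintro ⟨y, hy⟩
    rw [← h] at hy
    obtain ⟨z, hz, rfl⟩ := Finset.mem_image.1 hy
    exact ⟨⟨z, hz⟩, rfl⟩
  obtain ⟨n, hn, hp⟩ := (Finite.injective_iff_surjective.2 hg).mem_periodicPts ⟨x, hx⟩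
  refine ⟨n, hn, ?_⟩
  have hit : ∀ k (y : X), (g^[k] y : V) = f^[k] y := by
    intro k
    induction k with
    | zero => intro y; rfl
    | succ k ih => intro y; rw [Function.iterate_succ_apply, Function.iterate_succ_apply, ih]
  have := hit n ⟨x, hx⟩
  rw [hp.eq] at this
  exact this.symm

theorem image_forwardOrbit {V : Type*} [Fintype V] [DecidableEq V] {f : V → V} {x : V}
    (hx : x ∈ Function.periodicPts f) : (forwardOrbit f x).image f = forwardOrbit f x := by
  apply Finset.Subset.antisymm
  · intro y hy
    obtain ⟨z, hz, rfl⟩ := Finset.mem_image.1 hy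
    obtain ⟨k, rfl⟩ := mem_forwardOrbit.1 hz
    exact mem_forwardOrbit.2 ⟨k + 1, Function.iterate_succ_apply' f k x⟩
  · intro y hy
    obtain ⟨n, hn, hp⟩ := mem_periodicPts_of_mem_forwardOrbit hx hy
    obtain ⟨k, rfl⟩ := mem_forwardOrbit.1 hy
    refine Finset.mem_image.2 ⟨f^[n - 1] (f^[k] x), mem_forwardOrbit.2
      ⟨n - 1 + k, Function.iterate_add_apply f _ _ _⟩, ?_⟩
    rw [← Function.iterate_succ_apply' f, Nat.succ_eq_add_one, Nat.sub_add_cancel hn, hp.eq]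

/-- On such a set `f` is a permutation, so the set is a union of cycles; cycles that meet coincide,
so the union determines which cycles were used. -/
theorem card_filter_image_eq_self {V : Type*} [Fintype V] [DecidableEq V] (f : V → V) :
    (Finset.univ.filter fun X : Finset V => X.image f = X).card = 2 ^ (mapCycles f).card := by
  rw [← Finset.card_powerset]
  symm
  refine Finset.card_bij (fun T _ => T.biUnion id) ?_ ?_ ?_
  · intro T hT
    rw [Finset.mem_powerset] at hT
    rw [Finset.mem_filter, Finset.biUnion_image]
    refine ⟨Finset.mem_univ _, Finset.biUnion_congr rfl fun Z hZ => ?_⟩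
    obtain ⟨x, hx, rfl⟩ := mem_mapCycles.1 (hT hZ)
    exact image_forwardOrbit hx
  · have key : ∀ T ⊆ mapCycles f, ∀ T' ⊆ mapCycles f, T.biUnion id = T'.biUnion id → T ⊆ T' := by
      intro T hT T' hT' h Z hZ
      obtain ⟨x, hx, rfl⟩ := mem_mapCycles.1 (hT hZ)
      have hxT : x ∈ T.biUnion id := Finset.mem_biUnion.2 ⟨_, hZ, self_mem_forwardOrbit x⟩
      rw [h] at hxT
      obtain ⟨Z', hZ', hxZ'⟩ := Finset.mem_biUnion.1 hxT
      obtain ⟨y, hy, rfl⟩ := mem_mapCycles.1 (hT' hZ')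
      rwa [forwardOrbit_eq_of_mem hy hxZ']
    intro T hT T' hT' h
    rw [Finset.mem_powerset] at hT hT'
    exact Finset.Subset.antisymm (key T hT T' hT' h) (key T' hT' T hT h.symm)
  · intro X hX
    have hX' : X.image f = X := (Finset.mem_filter.1 hX).2
    refine ⟨X.image (forwardOrbit f), ?_, ?_⟩
    · rw [Finset.mem_powerset]
      intro Z hZ
      obtain ⟨x, hx, rfl⟩ := Finset.mem_image.1 hZ
      exact mem_mapCycles.2 ⟨x, mem_periodicPts_of_image_eq hX' hx, rfl⟩
    · ext y
      simp only [Finset.mem_biUnion, Finset.mem_image, id]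
      constructor
      · rintro ⟨_, ⟨x, hx, rfl⟩, hy⟩
        obtain ⟨k, rfl⟩ := mem_forwardOrbit.1 hy
        clear hy
        induction k with
        | zero => exact hx
        | succ k ih =>
          rw [Function.iterate_succ_apply', ← hX']
          exact Finset.mem_image_of_mem f ih
      · intro hy
        exact ⟨_, ⟨y, hy, rfl⟩, self_mem_forwardOrbit y⟩

/-! ### Counting the orientations of an edge set -/

namespace MultiGraph

/-- The oriented edge with the opposite orientation. -/
def rev {E : Type*} (d : E × Bool) : E × Bool := (d.1, !d.2)

theorem rev_fst {E : Type*} (d : E × Bool) : (rev d).1 = d.1 := rfl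

theorem rev_rev {E : Type*} (d : E × Bool) : rev (rev d) = d := by simp [rev]

theorem rev_ne {E : Type*} (d : E × Bool) : rev d ≠ d := by
  rcases d with ⟨e, b⟩; cases b <;> simp [rev]

theorem eq_or_eq_rev {E : Type*} {d d' : E × Bool} (h : d.1 = d'.1) : d = d' ∨ d = rev d' := by
  rcases d with ⟨e, b⟩; rcases d' with ⟨e', b'⟩
  cases b <;> cases b' <;> simp_all [rev]

variable {V E : Type*} (G : MultiGraph V E)

theorem head_rev (d : E × Bool) : G.head (rev d) = G.tail d := by
  rcases d with ⟨e, b⟩; cases b <;> rfl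

theorem tail_rev (d : E × Bool) : G.tail (rev d) = G.head d := by
  rcases d with ⟨e, b⟩; cases b <;> rfl

/-- A choice of pairwise distinct edges, one at each vertex, the set of chosen edges being `S`;
each of them is oriented towards the vertex that chooses it. -/
structure IsOrientation [Fintype V] [DecidableEq E] (S : Finset E) (D : V → E × Bool) : Prop where
  head_eq : ∀ v, G.head (D v) = v
  injective : Function.Injective fun v => (D v).1
  image_eq : Finset.univ.image (fun v => (D v).1) = S

namespace IsOrientation

variable {G} [Fintype V] [DecidableEq E] {S : Finset E} {D D' : V → E × Bool}

/-- The edge chosen at `v` by `D` lies in `S`, so `D'` chooses it at one of its two ends. -/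
theorem eq_or_apply_tail_eq (hD : G.IsOrientation S D) (hD' : G.IsOrientation S D') (v : V) :
    D' v = D v ∨ D' (G.tail (D v)) = rev (D v) := by
  have hv : (D v).1 ∈ Finset.univ.image (fun v => (D' v).1) := by
    rw [hD'.image_eq, ← hD.image_eq]
    exact Finset.mem_image_of_mem _ (Finset.mem_univ v)
  obtain ⟨u, -, hu⟩ := Finset.mem_image.1 hv
  rcases eq_or_eq_rev hu with h | h
  · have := hD'.head_eq u
    rw [h, hD.head_eq] at this
    exact Or.inl (this ▸ h)
  · have := hD'.head_eq u
    rw [h, head_rev] at this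
    exact Or.inr (this ▸ h)

theorem not_eq_and_apply_tail_eq (hD' : G.IsOrientation S D') (v : V) :
    ¬ (D' v = D v ∧ D' (G.tail (D v)) = rev (D v)) := by
  rintro ⟨h1, h2⟩
  have : G.tail (D v) = v := hD'.injective (by simp only [h1, h2, rev_fst])
  rw [this, h1] at h2
  exact rev_ne _ h2.symm

/-- Relative to `D`, another orientation is recorded by the set of `v` whose edge it reverses,
handing it to `f v`. Then `f v` must give up its own edge, so reversal propagates and `f` maps the
set onto itself. Conversely, any such set can be reversed. -/
theorem card_eq [DecidableEq V] [Fintype E] (hD : G.IsOrientation S D)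
    [DecidablePred (G.IsOrientation S)] :
    (Finset.univ.filter (G.IsOrientation S)).card =
      2 ^ (mapCycles fun v => G.tail (D v)).card := by
  rw [← card_filter_image_eq_self]
  set f : V → V := fun v => G.tail (D v) with hf
  refine Finset.card_bij (fun D' _ => Finset.univ.filter fun v => D' (f v) = rev (D v)) ?_ ?_ ?_
  · intro D' h
    have hD' := (Finset.mem_filter.1 h).2
    refine Finset.mem_filter.2 ⟨Finset.mem_univ _, Finset.eq_of_subset_of_card_le ?_ ?_⟩
    · intro y hy
      obtain ⟨v, hv, rfl⟩ := Finset.mem_image.1 hy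
      have hv := (Finset.mem_filter.1 hv).2
      refine Finset.mem_filter.2 ⟨Finset.mem_univ _, ?_⟩
      -- If `f v` also kept its own edge, `D` would use one edge at `v` and at `f v`; it would be a
      -- loop equal to its own reversal as an oriented edge.
      rcases eq_or_apply_tail_eq hD hD' (f v) with h | h
      · exfalso
        have h1 : (D (f v)).1 = (D v).1 := by rw [← h, hv, rev_fst]
        have h2 : f v = v := hD.injective h1
        rw [h2] at h hv
        exact rev_ne _ (hv.symm.trans h)
      · exact h
    · rw [Finset.card_image_of_injOn]
      intro v hv w hw hvw
      have hv := (Finset.mem_filter.1 (Finset.mem_coe.1 hv)).2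
      have hw := (Finset.mem_filter.1 (Finset.mem_coe.1 hw)).2
      have hvw' : f v = f w := hvw
      rw [hvw', hw] at hv
      exact hD.injective (by simpa [rev_fst] using (congrArg Prod.fst hv).symm)
  · intro D₁ h₁ D₂ h₂ h
    have hD₁ := (Finset.mem_filter.1 h₁).2
    have hD₂ := (Finset.mem_filter.1 h₂).2
    have hiff : ∀ v, D₁ (f v) = rev (D v) ↔ D₂ (f v) = rev (D v) := fun v => by
      simpa using Finset.ext_iff.1 h v
    funext v
    have hv : (D₁ v).1 ∈ Finset.univ.image (fun v => (D v).1) := by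
      rw [hD.image_eq, ← hD₁.image_eq]
      exact Finset.mem_image_of_mem _ (Finset.mem_univ v)
    obtain ⟨u, -, hu⟩ := Finset.mem_image.1 hv
    rcases eq_or_apply_tail_eq hD hD₁ u with h1 | h1
    · have huv : u = v := hD₁.injective (by simp only [h1, hu])
      subst huv
      rcases eq_or_apply_tail_eq hD hD₂ u with h2 | h2
      · rw [h1, h2]
      · exact absurd ⟨h1, (hiff u).2 h2⟩ (not_eq_and_apply_tail_eq hD₁ u)
    · have huv : f u = v := hD₁.injective (by simp only [hf, h1, hu, rev_fst])
      subst huv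
      rw [(hiff u).1 h1]
      exact h1
  · intro X hX
    have hX' : X.image f = X := (Finset.mem_filter.1 hX).2
    have hinj : Set.InjOn f X := Finset.injOn_of_card_image_eq (by rw [hX'])
    have hex : ∀ v, ∃ g, v ∈ X → g ∈ X ∧ f g = v := by
      intro v
      by_cases hv : v ∈ X
      · rw [← hX'] at hv
        obtain ⟨g, hg, hgv⟩ := Finset.mem_image.1 hv
        exact ⟨g, fun _ => ⟨hg, hgv⟩⟩
      · exact ⟨v, fun h => absurd h hv⟩
    choose g hg using hex
    -- `g` inverts `f` on `X`, so a vertex of `X` receives the reversed edge of its predecessor.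
    let D' : V → E × Bool := fun v => if v ∈ X then rev (D (g v)) else D v
    have hpos : ∀ v ∈ X, D' v = rev (D (g v)) := fun v hv => if_pos hv
    have hneg : ∀ v ∉ X, D' v = D v := fun v hv => if_neg hv
    have hinj' : Function.Injective fun v => (D' v).1 := by
      intro v w h
      have h' : (D' v).1 = (D' w).1 := h
      by_cases hv : v ∈ X <;> by_cases hw : w ∈ X
      · rw [hpos v hv, hpos w hw, rev_fst, rev_fst] at h'
        rw [← (hg v hv).2, hD.injective h', (hg w hw).2]
      · rw [hpos v hv, hneg w hw, rev_fst] at h'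
        exact absurd (hD.injective h' ▸ (hg v hv).1) hw
      · rw [hneg v hv, hpos w hw, rev_fst] at h'
        exact absurd (hD.injective h' ▸ (hg w hw).1) hv
      · rw [hneg v hv, hneg w hw] at h'
        exact hD.injective h'
    have hD' : G.IsOrientation S D' := by
      refine ⟨fun v => ?_, hinj', ?_⟩
      · by_cases hv : v ∈ X
        · rw [hpos v hv, head_rev]
          exact (hg v hv).2
        · rw [hneg v hv]
          exact hD.head_eq v
      · apply Finset.eq_of_subset_of_card_le
        · intro e he
          obtain ⟨v, -, rfl⟩ := Finset.mem_image.1 he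
          rw [← hD.image_eq]
          by_cases hv : v ∈ X
          · rw [hpos v hv, rev_fst]
            exact Finset.mem_image_of_mem _ (Finset.mem_univ _)
          · rw [hneg v hv]
            exact Finset.mem_image_of_mem _ (Finset.mem_univ _)
        · rw [← hD.image_eq, Finset.card_image_of_injective _ hinj',
            Finset.card_image_of_injective _ hD.injective]
    refine ⟨D', Finset.mem_filter.2 ⟨Finset.mem_univ _, hD'⟩, ?_⟩
    ext v
    rw [Finset.mem_filter, and_iff_right (Finset.mem_univ v)]
    constructor
    · intro h
      by_contra hv
      exact not_eq_and_apply_tail_eq hD' v ⟨hneg v hv, h⟩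
    · intro hv
      have hfv : f v ∈ X := hX' ▸ Finset.mem_image_of_mem f hv
      rw [hpos _ hfv, hinj (hg _ hfv).1 hv (hg _ hfv).2]

end IsOrientation

end MultiGraph

/-! ### Walks along and against an orientation -/

theorem minimalPeriod_eq_of_forall_ne {V : Type*} {f : V → V} {v : V} {n : ℕ} (hn : 0 < n)
    (hv : f^[n] v = v) (h : ∀ m, 0 < m → m < n → f^[m] v ≠ v) :
    Function.minimalPeriod f v = n := by
  have hp : Function.IsPeriodicPt f n v := hv
  rcases (hp.minimalPeriod_le hn).lt_or_eq with hlt | heq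
  · exact absurd Function.iterate_minimalPeriod (h _ (hp.minimalPeriod_pos hn) hlt)
  · exact heq

theorem forwardOrbit_eq_image_range {V : Type*} [Fintype V] [DecidableEq V] {f : V → V} {v : V}
    {n : ℕ} (hn : 0 < n) (hv : f^[n] v = v) :
    forwardOrbit f v = (Finset.range n).image fun k => f^[k] v := by
  ext y
  simp only [mem_forwardOrbit, Finset.mem_image, Finset.mem_range]
  constructor
  · rintro ⟨k, rfl⟩
    exact ⟨k % n, Nat.mod_lt _ hn, Function.IsPeriodicPt.iterate_mod_apply hv k⟩
  · rintro ⟨k, -, rfl⟩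
    exact ⟨k, rfl⟩

namespace MultiGraph

variable {V E : Type*} {G : MultiGraph V E}

/-- The list of oriented edges of a walk. -/
def Walk.darts : {u w : V} → G.Walk u w → List (E × Bool)
  | _, _, .nil _ => []
  | _, _, .cons d p => d :: p.darts

theorem Walk.edges_eq {u w : V} (p : G.Walk u w) : p.edges = p.darts.map Prod.fst := by
  induction p with
  | nil => rfl
  | cons d p ih => simp [Walk.edges, Walk.darts, ih]

theorem Walk.tails_eq {u w : V} (p : G.Walk u w) : p.tails = p.darts.map G.tail := by
  induction p with
  | nil => rfl
  | cons d p ih => simp [Walk.tails, Walk.darts, ih]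

theorem Walk.eq_or_exists_tail_eq {u w : V} (p : G.Walk u w) :
    u = w ∨ ∃ d ∈ p.darts, G.tail d = u := by
  cases p with
  | nil => exact Or.inl rfl
  | cons d p => exact Or.inr ⟨d, by simp [Walk.darts], rfl⟩

namespace IsOrientation

variable [Fintype V] [DecidableEq E] {S : Finset E} {D : V → E × Bool}

theorem apply_head_or_apply_tail (hD : G.IsOrientation S D) {d : E × Bool} (hd : d.1 ∈ S) :
    D (G.head d) = d ∨ D (G.tail d) = rev d := by
  rw [← hD.image_eq] at hd
  obtain ⟨u, -, hu⟩ := Finset.mem_image.1 hd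
  have hu' := hD.head_eq u
  rcases eq_or_eq_rev hu with h | h
  · rw [h] at hu'
    rw [hu']
    exact Or.inl h
  · rw [h, head_rev] at hu'
    rw [hu']
    exact Or.inr h

/-- The first edge is not chosen at its tail, so it is chosen at its head. No edge repeats, so the
same argument applies from there. -/
theorem forward_of_notMem (hD : G.IsOrientation S D) {u w : V} (p : G.Walk u w)
    (hS : ∀ e ∈ p.edges, e ∈ S) (hp : p.edges.Nodup) (hu : (D u).1 ∉ p.edges) :
    ∀ d ∈ p.darts, D (G.head d) = d := by
  induction p with
  | nil => intro d hd; simp [Walk.darts] at hd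
  | cons d p ih =>
    simp only [Walk.edges, List.mem_cons, List.nodup_cons, not_or, forall_eq_or_imp] at hS hp hu
    have h : D (G.head d) = d := by
      rcases hD.apply_head_or_apply_tail hS.1 with h | h
      · exact h
      · exact absurd (by rw [h, rev_fst]) hu.1
    intro d' hd'
    rcases List.mem_cons.1 hd' with rfl | hd'
    · exact h
    · exact ih hS.2 hp.2 (by rw [h]; exact hp.1) d' hd'

theorem backward_of_notMem (hD : G.IsOrientation S D) {u w : V} (p : G.Walk u w)
    (hS : ∀ e ∈ p.edges, e ∈ S) (hp : p.edges.Nodup) (hw : (D w).1 ∉ p.edges) :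
    ∀ d ∈ p.darts, D (G.tail d) = rev d := by
  induction p with
  | nil => intro d hd; simp [Walk.darts] at hd
  | cons d p ih =>
    simp only [Walk.edges, List.mem_cons, List.nodup_cons, not_or, forall_eq_or_imp] at hS hp hw
    have ih' := ih hS.2 hp.2 hw.2
    intro d' hd'
    rcases List.mem_cons.1 hd' with rfl | hd'
    · rcases hD.apply_head_or_apply_tail hS.1 with h | h
      · exfalso
        -- Suppose the head chose this edge. If the head is `w`, this contradicts `hw`; otherwise
        -- the induction hypothesis makes the head choose a later edge, which would repeat this one.
        rcases p.eq_or_exists_tail_eq with hx | ⟨d₂, hd₂, hx⟩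
        · exact hw.1 (by rw [← hx, h])
        · have h2 := ih' d₂ hd₂
          rw [hx, h] at h2
          apply hp.1
          rw [Walk.edges_eq]
          exact List.mem_map.2 ⟨d₂, hd₂, by rw [h2, rev_fst]⟩
      · exact h
    · exact ih' d' hd'

/-- Whichever end chooses the first edge, the rest of the walk avoids that edge; closedness lets the
backward case start from the final vertex. -/
theorem forward_or_backward (hD : G.IsOrientation S D) {v : V} (p : G.Walk v v)
    (hS : ∀ e ∈ p.edges, e ∈ S) (hp : p.edges.Nodup) :
    (∀ d ∈ p.darts, D (G.head d) = d) ∨ ∀ d ∈ p.darts, D (G.tail d) = rev d := by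
  suffices ∀ {u w : V} (p : G.Walk u w), u = w → (∀ e ∈ p.edges, e ∈ S) → p.edges.Nodup →
      (∀ d ∈ p.darts, D (G.head d) = d) ∨ ∀ d ∈ p.darts, D (G.tail d) = rev d from
    this p rfl hS hp
  intro u w p huw hS hp
  cases p with
  | nil => left; intro d hd; simp [Walk.darts] at hd
  | cons d p =>
    simp only [Walk.edges, List.mem_cons, List.nodup_cons, forall_eq_or_imp] at hS hp
    simp only [Walk.darts, List.mem_cons, forall_eq_or_imp]
    rcases hD.apply_head_or_apply_tail hS.1 with h | h
    · exact Or.inl ⟨h, hD.forward_of_notMem p hS.2 hp.2 (by rw [h]; exact hp.1)⟩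
    · refine Or.inr ⟨h, hD.backward_of_notMem p hS.2 hp.2 ?_⟩
      have h' : (D w).1 = d.1 := by rw [← huw, h, rev_fst]
      rw [h']
      exact hp.1

end IsOrientation

section

variable {D : V → E × Bool}

/-- The self-map goes from the head of a chosen edge to its tail, so it retraces such a walk from
its end; hence the reversed list. -/
theorem Walk.forward_spec {u w : V} (p : G.Walk u w) (h : ∀ d ∈ p.darts, D (G.head d) = d) :
    (fun v => G.tail (D v))^[p.darts.length] w = u ∧
      (p.darts.map G.head).reverse =
        (List.range p.darts.length).map fun k => (fun v => G.tail (D v))^[k] w := by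
  induction p with
  | nil => exact ⟨rfl, rfl⟩
  | cons d p ih =>
    simp only [Walk.darts, List.mem_cons, forall_eq_or_imp] at h
    obtain ⟨h1, h2⟩ := ih h.2
    simp only [Walk.darts, List.length_cons, List.map_cons, List.reverse_cons, h2,
      Function.iterate_succ_apply', h1, h.1, List.range_succ, List.map_append, List.map_nil,
      and_self]

theorem Walk.backward_spec {u w : V} (p : G.Walk u w) (h : ∀ d ∈ p.darts, D (G.tail d) = rev d) :
    (fun v => G.tail (D v))^[p.darts.length] u = w ∧
      p.darts.map G.tail =
        (List.range p.darts.length).map fun k => (fun v => G.tail (D v))^[k] u := by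
  induction p with
  | nil => exact ⟨rfl, rfl⟩
  | cons d p ih =>
    simp only [Walk.darts, List.mem_cons, forall_eq_or_imp] at h
    obtain ⟨h1, h2⟩ := ih h.2
    have hf : G.tail (D (G.tail d)) = G.head d := by rw [h.1, tail_rev]
    simp only [Walk.darts, List.length_cons, List.map_cons, h2, Function.iterate_succ_apply, hf,
      h1, List.range_succ_eq_map, List.map_map, true_and, Function.comp_def]
    rfl

theorem Walk.exists_backward (hD : ∀ v, G.head (D v) = v) (n : ℕ) (u w : V)
    (h : (fun v => G.tail (D v))^[n] u = w) :
    ∃ p : G.Walk u w,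
      p.darts = (List.range n).map fun k => rev (D ((fun v => G.tail (D v))^[k] u)) := by
  induction n generalizing u with
  | zero =>
    subst h
    exact ⟨.nil u, rfl⟩
  | succ n ih =>
    have ht : G.tail (rev (D u)) = u := by rw [tail_rev, hD]
    have hh : G.head (rev (D u)) = G.tail (D u) := head_rev G _
    obtain ⟨p, hp⟩ := ih (G.head (rev (D u))) (by rw [hh, ← h]; rfl)
    have : ∃ p : G.Walk (G.tail (rev (D u))) w, p.darts =
        (List.range (n + 1)).map fun k => rev (D ((fun v => G.tail (D v))^[k] u)) := by
      refine ⟨.cons _ p, ?_⟩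
      rw [Walk.darts, hp, hh, List.range_succ_eq_map, List.map_cons, List.map_map]
      rfl
    rwa [ht] at this

end

/-! ### Matrices of parallel transport -/

namespace Connection

variable {F : V → Type*} [∀ v, AddCommGroup (F v)] [∀ v, Module ℂ (F v)] (Φ : G.Connection F)
  (frame : ∀ v, F v ≃ₗ[ℂ] (Fin 2 → ℂ))

/-- The matrix of the parallel transport along an oriented edge. -/
noncomputable def dartMatrix (d : E × Bool) : Matrix (Fin 2) (Fin 2) ℂ :=
  LinearMap.toMatrix' ((frame (G.head d)).toLinearMap ∘ₗ
    (Φ.transport d).toLinearMap ∘ₗ (frame (G.tail d)).symm.toLinearMap)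

/-- The matrix of the parallel transport along a walk. -/
noncomputable def walkMatrix {u w : V} (p : G.Walk u w) : Matrix (Fin 2) (Fin 2) ℂ :=
  LinearMap.toMatrix' ((frame w).toLinearMap ∘ₗ
    (Φ.walkTransport p).toLinearMap ∘ₗ (frame u).symm.toLinearMap)

theorem walkMatrix_nil (u : V) : Φ.walkMatrix frame (.nil u) = 1 := by
  rw [walkMatrix, ← LinearMap.toMatrix'_id]
  congr 1
  ext x
  simp [walkTransport]

theorem walkMatrix_cons (d : E × Bool) {w : V} (p : G.Walk (G.head d) w) :
    Φ.walkMatrix frame (.cons d p) = Φ.walkMatrix frame p * Φ.dartMatrix frame d := by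
  rw [walkMatrix, walkMatrix, dartMatrix, ← LinearMap.toMatrix'_comp]
  congr 1
  ext x
  simp [walkTransport]

theorem trace_walkMatrix {v : V} (p : G.Walk v v) :
    (Φ.walkMatrix frame p).trace = LinearMap.trace ℂ (F v) (Φ.walkTransport p).toLinearMap := by
  rw [← LinearMap.trace_conj' _ (frame v), walkMatrix,
    LinearMap.trace_eq_matrix_trace ℂ (Pi.basisFun ℂ (Fin 2))]
  rfl

theorem dartMatrix_rev_mul (d : E × Bool) :
    Φ.dartMatrix frame (rev d) * Φ.dartMatrix frame d = 1 := by
  have h1 : ∀ e, Φ.dartMatrix frame (e, true) = LinearMap.toMatrix' ((frame (G.tgt e)).toLinearMap ∘ₗ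
      (Φ.edgeTransport e).toLinearMap ∘ₗ (frame (G.src e)).symm.toLinearMap) := fun _ => rfl
  have h2 : ∀ e, Φ.dartMatrix frame (e, false) = LinearMap.toMatrix' ((frame (G.src e)).toLinearMap ∘ₗ
      (Φ.edgeTransport e).symm.toLinearMap ∘ₗ (frame (G.tgt e)).symm.toLinearMap) := fun _ => rfl
  rcases d with ⟨e, _ | _⟩
  · change Φ.dartMatrix frame (e, true) * Φ.dartMatrix frame (e, false) = 1
    rw [h1, h2, ← LinearMap.toMatrix'_comp, ← LinearMap.toMatrix'_id]
    congr 1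
    ext x
    simp
  · change Φ.dartMatrix frame (e, false) * Φ.dartMatrix frame (e, true) = 1
    rw [h1, h2, ← LinearMap.toMatrix'_comp, ← LinearMap.toMatrix'_id]
    congr 1
    ext x
    simp

variable {Φ frame}

theorem det_dartMatrix (hΦ : Φ.IsSL2 frame) (d : E × Bool) : (Φ.dartMatrix frame d).det = 1 := by
  have h : ∀ e, (Φ.dartMatrix frame (e, true)).det = 1 := hΦ
  rcases d with ⟨e, _ | _⟩
  · have := congrArg Matrix.det (Φ.dartMatrix_rev_mul frame (e, true))
    rwa [Matrix.det_mul, h, mul_one, Matrix.det_one] at this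
  · exact h e

theorem dartMatrix_rev (hΦ : Φ.IsSL2 frame) (d : E × Bool) :
    Φ.dartMatrix frame (rev d) = (Φ.dartMatrix frame d).adjugate := by
  have h := Matrix.mul_adjugate (Φ.dartMatrix frame d)
  rw [det_dartMatrix hΦ, one_smul] at h
  exact left_inv_eq_right_inv (Φ.dartMatrix_rev_mul frame d) h

theorem walkMatrix_of_forward {D : V → E × Bool} {u w : V} (p : G.Walk u w)
    (h : ∀ d ∈ p.darts, D (G.head d) = d) :
    Φ.walkMatrix frame p = ((List.range p.darts.length).map fun k =>
      Φ.dartMatrix frame (D ((fun v => G.tail (D v))^[k] w))).prod := by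
  induction p with
  | nil => exact Φ.walkMatrix_nil frame _
  | cons d p ih =>
    simp only [Walk.darts, List.mem_cons, forall_eq_or_imp] at h
    rw [walkMatrix_cons, ih h.2, Walk.darts, List.length_cons, List.range_succ, List.map_append,
      List.prod_append, List.map_singleton, List.prod_singleton, (p.forward_spec h.2).1, h.1]

/-- Each step reverses a chosen edge, so its matrix is an adjugate by determinant `1`; taking
adjugates also reverses the order of the product. -/
theorem walkMatrix_of_backward (hΦ : Φ.IsSL2 frame) {D : V → E × Bool} {u w : V} (p : G.Walk u w)
    (h : ∀ d ∈ p.darts, D (G.tail d) = rev d) :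
    Φ.walkMatrix frame p = ((List.range p.darts.length).map fun k =>
      Φ.dartMatrix frame (D ((fun v => G.tail (D v))^[k] u))).prod.adjugate := by
  induction p with
  | nil =>
    rw [walkMatrix_nil]
    exact Matrix.adjugate_one.symm
  | cons d p ih =>
    simp only [Walk.darts, List.mem_cons, forall_eq_or_imp] at h
    have hf : G.tail (D (G.tail d)) = G.head d := by rw [h.1, tail_rev]
    rw [walkMatrix_cons, ih h.2, Walk.darts, List.length_cons, List.range_succ_eq_map,
      List.map_cons, List.prod_cons, List.map_map, Matrix.adjugate_mul_distrib]
    congr 1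
    · simp only [Function.comp_def, Function.iterate_succ_apply, hf]
    · rw [Function.iterate_zero, id, h.1, ← dartMatrix_rev hΦ, rev_rev]

end Connection

end MultiGraph

theorem Matrix.trace_adjugate_fin_two {R : Type*} [CommRing R] (A : Matrix (Fin 2) (Fin 2) R) :
    A.adjugate.trace = A.trace := by
  simp [Matrix.adjugate_fin_two, Matrix.trace_fin_two, add_comm]

/-! ### CRSFs are exactly the orientable edge sets -/

namespace MultiGraph

variable {V E : Type*} {G : MultiGraph V E} {S : Finset E}

theorem exists_dart_head_eq {e : E} {v : V} (h : G.src e = v ∨ G.tgt e = v) :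
    ∃ d : E × Bool, d.1 = e ∧ G.head d = v := by
  rcases h with h | h
  · exact ⟨(e, false), rfl, h⟩
  · exact ⟨(e, true), rfl, h⟩

theorem src_eq_or_tgt_eq (d : E × Bool) : G.src d.1 = G.head d ∨ G.tgt d.1 = G.head d := by
  rcases d with ⟨e, _ | _⟩
  · exact Or.inl rfl
  · exact Or.inr rfl

theorem src_eq_head_or_tail (d : E × Bool) : G.src d.1 = G.head d ∨ G.src d.1 = G.tail d := by
  rcases d with ⟨e, _ | _⟩
  · exact Or.inl rfl
  · exact Or.inr rfl

theorem reachIn_iff_reflTransGen {u w : V} : G.ReachIn S u w ↔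
    Relation.ReflTransGen (fun x y => ∃ d : E × Bool, d.1 ∈ S ∧ G.tail d = x ∧ G.head d = y)
      u w := by
  constructor
  · rintro ⟨p, hp⟩
    induction p with
    | nil => exact .refl
    | cons d p ih =>
      simp only [Walk.edges, List.mem_cons, forall_eq_or_imp] at hp
      exact (ih hp.2).head ⟨d, hp.1, rfl, rfl⟩
  · intro h
    induction h using Relation.ReflTransGen.head_induction_on with
    | refl => exact ⟨.nil _, by simp [Walk.edges]⟩
    | head h _ ih =>
      obtain ⟨d, hd, rfl, rfl⟩ := h
      obtain ⟨p, hp⟩ := ih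
      exact ⟨.cons d p, by simpa [Walk.edges, hd] using hp⟩

theorem ReachIn.refl (v : V) : G.ReachIn S v v := ⟨.nil v, by simp [Walk.edges]⟩

theorem ReachIn.trans {u v w : V} (h : G.ReachIn S u v) (h' : G.ReachIn S v w) :
    G.ReachIn S u w := by
  rw [reachIn_iff_reflTransGen] at *
  exact Relation.ReflTransGen.trans h h'

theorem ReachIn.symm {u v : V} (h : G.ReachIn S u v) : G.ReachIn S v u := by
  rw [reachIn_iff_reflTransGen] at *
  refine Relation.reflTransGen_swap.1 (Relation.ReflTransGen.mono ?_ _ _ h)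
  rintro x y ⟨d, hd, rfl, rfl⟩
  exact ⟨rev d, hd, tail_rev G d, head_rev G d⟩

theorem reachIn_of_dart {d : E × Bool} (hd : d.1 ∈ S) : G.ReachIn S (G.tail d) (G.head d) :=
  reachIn_iff_reflTransGen.2 (.single ⟨d, hd, rfl, rfl⟩)

theorem reachIn_src {d : E × Bool} (hd : d.1 ∈ S) : G.ReachIn S (G.head d) (G.src d.1) := by
  rcases src_eq_head_or_tail (G := G) d with h | h
  · rw [h]; exact .refl _
  · rw [h]; exact (reachIn_of_dart hd).symm

/-- A chosen edge stays in the component of its vertex, so the choice matches vertices and edges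
component by component. -/
theorem IsOrientation.isCRSF [Fintype V] [DecidableEq E] {D : V → E × Bool}
    (hD : G.IsOrientation S D) : G.IsCRSF S := by
  have hmem : ∀ v, (D v).1 ∈ S := fun v => by
    rw [← hD.image_eq]
    exact Finset.mem_image_of_mem _ (Finset.mem_univ v)
  refine ⟨fun v => ⟨(D v).1, hmem v, ?_⟩, fun v => ?_⟩
  · have := src_eq_or_tgt_eq (G := G) (D v)
    rwa [hD.head_eq] at this
  · rw [← Set.ncard_image_of_injective _ hD.injective]
    congr 1
    ext e
    constructor
    · rintro ⟨u, hu, rfl⟩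
      have := reachIn_src (G := G) (hmem u)
      rw [hD.head_eq] at this
      exact ⟨hmem u, ReachIn.trans hu this⟩
    · rintro ⟨he, hr⟩
      rw [← hD.image_eq] at he
      obtain ⟨u, -, rfl⟩ := Finset.mem_image.1 he
      have := reachIn_src (G := G) (hmem u)
      rw [hD.head_eq] at this
      exact ⟨u, hr.trans this.symm, rfl⟩

/-- From a vertex `v` there is a walk of length `n` in `S` which ends in `B`. -/
def ReachesIn (G : MultiGraph V E) (S : Finset E) (B : Set V) : ℕ → V → Prop
  | 0, v => v ∈ B
  | n + 1, v => ∃ d : E × Bool, d.1 ∈ S ∧ G.head d = v ∧ ReachesIn G S B n (G.tail d)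

theorem ReachIn.exists_reachesIn {B : Set V} {v b : V} (h : G.ReachIn S v b) (hb : b ∈ B) :
    ∃ n, G.ReachesIn S B n v := by
  rw [reachIn_iff_reflTransGen] at h
  induction h using Relation.ReflTransGen.head_induction_on with
  | refl => exact ⟨0, hb⟩
  | head h _ ih =>
    obtain ⟨d, hd, rfl, rfl⟩ := h
    obtain ⟨n, hn⟩ := ih
    exact ⟨n + 1, rev d, hd, head_rev G d, by rwa [tail_rev]⟩

/-- Each vertex takes the first edge of a shortest path to `B`. Distances strictly decrease along
these edges, so no edge serves both its ends. -/
theorem exists_parent (G : MultiGraph V E) (S : Finset E) (B : Set V) :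
    ∃ p : {v // v ∉ B ∧ ∃ b ∈ B, G.ReachIn S v b} → E × Bool,
      (∀ v, (p v).1 ∈ S ∧ G.head (p v) = v) ∧ Function.Injective fun v => (p v).1 := by
  classical
  let rank : V → ℕ := fun v => sInf {n | G.ReachesIn S B n v}
  have h : ∀ v : {v // v ∉ B ∧ ∃ b ∈ B, G.ReachIn S v b}, ∃ d : E × Bool,
      d.1 ∈ S ∧ G.head d = v ∧ rank (G.tail d) < rank v := by
    rintro ⟨v, hv, b, hb, hvb⟩
    have hne : {n | G.ReachesIn S B n v}.Nonempty := hvb.exists_reachesIn hb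
    have hmem := Nat.sInf_mem hne
    change G.ReachesIn S B (rank v) v at hmem
    cases hr : rank v with
    | zero => rw [hr] at hmem; exact absurd hmem hv
    | succ k =>
      rw [hr] at hmem
      obtain ⟨d, hd, hdv, hk⟩ := hmem
      refine ⟨d, hd, hdv, ?_⟩
      exact Nat.lt_succ_of_le (Nat.sInf_le hk)
  choose p hp using h
  refine ⟨p, fun v => ⟨(hp v).1, (hp v).2.1⟩, fun v w hvw => ?_⟩
  rcases eq_or_eq_rev hvw with h | h
  · apply Subtype.ext
    rw [← (hp v).2.1, ← (hp w).2.1, h]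
  · exfalso
    have h1 := (hp v).2.2
    have h2 := (hp w).2.2
    have h3 : G.head (p v) = G.tail (p w) := by rw [h, head_rev]
    have h4 : G.tail (p v) = G.head (p w) := by rw [h, tail_rev]
    rw [h4, (hp w).2.1] at h1
    rw [← h3, (hp v).2.1] at h2
    omega

/-- `A` is a union of components, over which the equality of vertex and edge counts is summed. -/
theorem IsCRSF.card_eq_of_closed [Fintype V] [DecidableEq V] (hS : G.IsCRSF S)
    (A : Finset V) (hA : ∀ v ∈ A, ∀ w, G.ReachIn S v w → w ∈ A) :
    A.card = (S.filter fun e => G.src e ∈ A).card := by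
  classical
  let comp : V → Finset V := fun v => Finset.univ.filter fun w => G.ReachIn S v w
  have hcomp : ∀ v w, comp v = comp w ↔ G.ReachIn S w v := by
    intro v w
    constructor
    · intro h
      have : v ∈ comp v := Finset.mem_filter.2 ⟨Finset.mem_univ _, .refl v⟩
      rw [h] at this
      exact (Finset.mem_filter.1 this).2
    · intro h
      refine Finset.filter_congr fun x _ => ⟨fun hx => h.trans hx, fun hx => h.symm.trans hx⟩
  rw [Finset.card_eq_sum_card_fiberwise (f := comp) (t := A.image comp)
      fun v hv => Finset.mem_image_of_mem comp hv,
    Finset.card_eq_sum_card_fiberwise (s := S.filter fun e => G.src e ∈ A)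
      (f := fun e => comp (G.src e)) (t := A.image comp)
      fun e he => Finset.mem_image_of_mem comp (Finset.mem_filter.1 he).2]
  refine Finset.sum_congr rfl fun K hK => ?_
  obtain ⟨v, hv, rfl⟩ := Finset.mem_image.1 hK
  have h := hS.2 v
  have h1 : {w | G.ReachIn S v w} = ((A.filter fun w => comp w = comp v : Finset V) : Set V) := by
    ext w
    simp only [Set.mem_ofPred_eq, Finset.coe_filter, hcomp]
    exact ⟨fun hw => ⟨hA v hv w hw, hw⟩, fun hw => hw.2⟩
  have h2 : {e | e ∈ S ∧ G.ReachIn S v (G.src e)} =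
      (((S.filter fun e => G.src e ∈ A).filter fun e => comp (G.src e) = comp v : Finset E) :
        Set E) := by
    ext e
    simp only [Set.mem_ofPred_eq, Finset.coe_filter, hcomp, Finset.mem_filter]
    exact ⟨fun he => ⟨⟨he.1, hA v hv _ he.2⟩, he.2⟩, fun he => ⟨he.1.1, he.2⟩⟩
  rw [h1, h2, Set.ncard_coe_finset, Set.ncard_coe_finset] at h
  exact h

/-- Hall's theorem for vertices and incident edges. In a vertex set `A`, the vertices connected to
the complement of `A` have distinct parent edges; the others form whole components, with as many
edges as vertices. These two families of edges lie in different components. -/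
theorem IsCRSF.exists_isOrientation [Fintype V] [DecidableEq E] (hS : G.IsCRSF S) :
    ∃ D : V → E × Bool, G.IsOrientation S D := by
  classical
  let t : V → Finset E := fun v => S.filter fun e => G.src e = v ∨ G.tgt e = v
  have hhall : ∀ A : Finset V, A.card ≤ (A.biUnion t).card := by
    intro A
    let B : Set V := {v | v ∉ A}
    obtain ⟨p, hp, hinj⟩ := exists_parent G S B
    let A₁ := A.filter fun v => ∃ b ∈ B, G.ReachIn S v b
    let A₂ := A.filter fun v => ¬ ∃ b ∈ B, G.ReachIn S v b
    have hcl : ∀ v ∈ A₂, ∀ w, G.ReachIn S v w → w ∈ A₂ := by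
      intro v hv w hw
      have hv' := (Finset.mem_filter.1 hv).2
      refine Finset.mem_filter.2 ⟨?_, ?_⟩
      · by_contra hwA
        exact hv' ⟨w, hwA, hw⟩
      · rintro ⟨b, hb, hwb⟩
        exact hv' ⟨b, hb, hw.trans hwb⟩
    have hmem₁ : ∀ v ∈ A₁, v ∉ B ∧ ∃ b ∈ B, G.ReachIn S v b := fun v hv =>
      ⟨fun h => h (Finset.mem_filter.1 hv).1, (Finset.mem_filter.1 hv).2⟩
    let P : Finset E := A₁.attach.image fun v : {v // v ∈ A₁} => (p ⟨v, hmem₁ v v.2⟩).1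
    have hPcard : P.card = A₁.card := by
      rw [Finset.card_image_of_injective, Finset.card_attach]
      intro v w h
      exact Subtype.ext (congrArg (fun x => x.1) (hinj h))
    have hP : ∀ e ∈ P, e ∈ S ∧ ∃ v ∈ A₁, (G.src e = v ∨ G.tgt e = v) ∧ G.ReachIn S v (G.src e) := by
      intro e he
      obtain ⟨v, -, rfl⟩ := Finset.mem_image.1 he
      obtain ⟨h1, h2⟩ := hp ⟨v, hmem₁ v v.2⟩
      have h3 := src_eq_or_tgt_eq (G := G) (p ⟨v, hmem₁ v v.2⟩)
      have h4 := reachIn_src (G := G) h1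
      rw [h2] at h3 h4
      exact ⟨h1, v, v.2, h3, h4⟩
    have hdisj : Disjoint P (S.filter fun e => G.src e ∈ A₂) := by
      rw [Finset.disjoint_left]
      intro e he he'
      obtain ⟨-, v, hv, -, hr⟩ := hP e he
      have := hcl _ (Finset.mem_filter.1 he').2 v hr.symm
      exact (Finset.mem_filter.1 this).2 (Finset.mem_filter.1 hv).2
    calc A.card = A₁.card + A₂.card := (Finset.card_filter_add_card_filter_not _).symm
      _ = P.card + (S.filter fun e => G.src e ∈ A₂).card := by
        rw [hPcard, ← hS.card_eq_of_closed A₂ hcl]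
      _ = (P ∪ S.filter fun e => G.src e ∈ A₂).card := (Finset.card_union_of_disjoint hdisj).symm
      _ ≤ (A.biUnion t).card := by
        apply Finset.card_le_card
        intro e he
        rw [Finset.mem_biUnion]
        rcases Finset.mem_union.1 he with he | he
        · obtain ⟨h1, v, hv, h2, -⟩ := hP e he
          exact ⟨v, (Finset.mem_filter.1 hv).1, Finset.mem_filter.2 ⟨h1, h2⟩⟩
        · obtain ⟨h1, h2⟩ := Finset.mem_filter.1 he
          exact ⟨_, (Finset.mem_filter.1 h2).1, Finset.mem_filter.2 ⟨h1, Or.inl rfl⟩⟩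
  obtain ⟨g, hg, hgt⟩ := (Finset.all_card_le_biUnion_card_iff_exists_injective t).1 hhall
  have hg' := fun v => Finset.mem_filter.1 (hgt v)
  choose D hD using fun v => exists_dart_head_eq (hg' v).2
  have hDg : (fun v => (D v).1) = g := funext fun v => (hD v).1
  refine ⟨D, fun v => (hD v).2, by rwa [hDg], ?_⟩
  rw [hDg]
  apply Finset.eq_of_subset_of_card_le
  · intro e he
    obtain ⟨v, -, rfl⟩ := Finset.mem_image.1 he
    exact (hg' v).1
  -- Applied to all of `V`, the component count gives `|S| = |V|`, so the injective choice exhausts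
  -- `S`.
  · rw [Finset.card_image_of_injective _ hg,
      hS.card_eq_of_closed Finset.univ fun _ _ w _ => Finset.mem_univ w]
    simp

end MultiGraph

/-! ### Cycles and monodromy of an oriented edge set -/

namespace MultiGraph

variable {V E : Type*} {G : MultiGraph V E}

namespace IsOrientation

variable [Fintype V] [DecidableEq E] {S : Finset E} {D : V → E × Bool}

theorem cyclic_forward [DecidableEq V] {v : V} {p : G.Walk v v} (hp : p.IsCyclic)
    (h : ∀ d ∈ p.darts, D (G.head d) = d) :
    v ∈ Function.periodicPts (fun v => G.tail (D v)) ∧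
      Function.minimalPeriod (fun v => G.tail (D v)) v = p.darts.length ∧
      ∀ e, e ∈ p.edges ↔ e ∈ (forwardOrbit (fun v => G.tail (D v)) v).image fun u => (D u).1 := by
  obtain ⟨hne, -, hnd⟩ := hp
  rw [Walk.edges_eq] at hne
  rw [Walk.tails_eq] at hnd
  obtain ⟨h1, h2⟩ := p.forward_spec h
  set f : V → V := fun v => G.tail (D v) with hf
  have hpos : 0 < p.darts.length := List.length_pos_iff.2 fun h0 => hne (by rw [h0]; rfl)
  have htails : (p.darts.map G.tail).reverse =
      (List.range p.darts.length).map fun k => f^[k + 1] v := by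
    have : p.darts.map G.tail = (p.darts.map G.head).map f := by
      rw [List.map_map]
      refine List.map_congr_left fun d hd => ?_
      simp only [Function.comp_apply, hf, h d hd]
    rw [this, ← List.map_reverse, h2, List.map_map]
    refine List.map_congr_left fun k _ => ?_
    rw [Function.comp_apply, Function.iterate_succ_apply']
  rw [← List.nodup_reverse, htails] at hnd
  have hinj := List.inj_on_of_nodup_map hnd
  refine ⟨⟨_, hpos, h1⟩, minimalPeriod_eq_of_forall_ne hpos h1 fun m hm hmn hmv => ?_, fun e => ?_⟩
  -- The reversed tails are the iterates with exponents `1, …, n`, so equality of exponents `m` and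
  -- `n` is read at indices `m - 1` and `n - 1`.
  · have := hinj (x := m - 1) (y := p.darts.length - 1) (by rw [List.mem_range]; omega)
      (by rw [List.mem_range]; omega)
      (by rw [Nat.sub_add_cancel hm, Nat.sub_add_cancel hpos, hmv, h1])
    omega
  · have hmem : ∀ u, u ∈ forwardOrbit f v ↔ u ∈ p.darts.map G.head := fun u => by
      rw [← List.mem_reverse, h2, forwardOrbit_eq_image_range hpos h1]
      simp [eq_comm]
    rw [Walk.edges_eq, Finset.mem_image]
    constructor
    · intro he
      obtain ⟨d, hd, rfl⟩ := List.mem_map.1 he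
      exact ⟨G.head d, (hmem _).2 (List.mem_map_of_mem hd), by rw [h d hd]⟩
    · rintro ⟨u, hu, rfl⟩
      obtain ⟨d, hd, rfl⟩ := List.mem_map.1 ((hmem _).1 hu)
      rw [h d hd]
      exact List.mem_map_of_mem hd

theorem cyclic_backward [DecidableEq V] {v : V} {p : G.Walk v v} (hp : p.IsCyclic)
    (h : ∀ d ∈ p.darts, D (G.tail d) = rev d) :
    v ∈ Function.periodicPts (fun v => G.tail (D v)) ∧
      Function.minimalPeriod (fun v => G.tail (D v)) v = p.darts.length ∧
      ∀ e, e ∈ p.edges ↔ e ∈ (forwardOrbit (fun v => G.tail (D v)) v).image fun u => (D u).1 := by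
  obtain ⟨hne, -, hnd⟩ := hp
  rw [Walk.edges_eq] at hne
  rw [Walk.tails_eq] at hnd
  obtain ⟨h1, h2⟩ := p.backward_spec h
  set f : V → V := fun v => G.tail (D v) with hf
  have hpos : 0 < p.darts.length := List.length_pos_iff.2 fun h0 => hne (by rw [h0]; rfl)
  rw [h2] at hnd
  have hinj := List.inj_on_of_nodup_map hnd
  refine ⟨⟨_, hpos, h1⟩, minimalPeriod_eq_of_forall_ne hpos h1 fun m hm hmn hmv => ?_, fun e => ?_⟩
  · have := hinj (x := m) (y := 0) (by rw [List.mem_range]; omega)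
      (by rw [List.mem_range]; omega) hmv
    omega
  · have hmem : ∀ u, u ∈ forwardOrbit f v ↔ u ∈ p.darts.map G.tail := fun u => by
      rw [h2, forwardOrbit_eq_image_range hpos h1]
      simp [eq_comm]
    rw [Walk.edges_eq, Finset.mem_image]
    constructor
    · intro he
      obtain ⟨d, hd, rfl⟩ := List.mem_map.1 he
      exact ⟨G.tail d, (hmem _).2 (List.mem_map_of_mem hd), by rw [h d hd, rev_fst]⟩
    · rintro ⟨u, hu, rfl⟩
      obtain ⟨d, hd, rfl⟩ := List.mem_map.1 ((hmem _).1 hu)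
      rw [h d hd]
      exact List.mem_map.2 ⟨d, hd, rfl⟩

theorem cyclic_spec [DecidableEq V] (hD : G.IsOrientation S D) {v : V} {p : G.Walk v v}
    (hp : p.IsCyclic) (hS : ∀ e ∈ p.edges, e ∈ S) :
    v ∈ Function.periodicPts (fun v => G.tail (D v)) ∧
      ∀ e, e ∈ p.edges ↔ e ∈ (forwardOrbit (fun v => G.tail (D v)) v).image fun u => (D u).1 := by
  rcases hD.forward_or_backward p hS hp.2.1 with h | h
  · exact ⟨(cyclic_forward hp h).1, (cyclic_forward hp h).2.2⟩
  · exact ⟨(cyclic_backward hp h).1, (cyclic_backward hp h).2.2⟩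

theorem isCycle_image_forwardOrbit [DecidableEq V] (hD : G.IsOrientation S D) {v : V}
    (hv : v ∈ Function.periodicPts (fun v => G.tail (D v))) :
    G.IsCycle ((forwardOrbit (fun v => G.tail (D v)) v).image fun u => (D u).1) := by
  set f : V → V := fun v => G.tail (D v) with hf
  have hpos := Function.minimalPeriod_pos_of_mem_periodicPts hv
  obtain ⟨p, hp⟩ := Walk.exists_backward hD.head_eq (Function.minimalPeriod f v) v v
    Function.iterate_minimalPeriod
  have hlen : p.darts.length = Function.minimalPeriod f v := by
    rw [hp, List.length_map, List.length_range]
  have hback : ∀ d ∈ p.darts, D (G.tail d) = rev d := by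
    intro d hd
    rw [hp] at hd
    obtain ⟨k, -, rfl⟩ := List.mem_map.1 hd
    rw [tail_rev, hD.head_eq, rev_rev]
  have hnd : ((List.range (Function.minimalPeriod f v)).map fun k => f^[k] v).Nodup := by
    refine List.Nodup.map_on (fun a ha b hb hab => ?_) List.nodup_range
    exact Function.iterate_injOn_Iio_minimalPeriod (List.mem_range.1 ha) (List.mem_range.1 hb) hab
  have hcyc : p.IsCyclic := by
    refine ⟨?_, ?_, ?_⟩
    · rw [Walk.edges_eq]
      intro h
      rw [← List.length_eq_zero_iff, List.length_map, hlen] at h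
      omega
    · rw [Walk.edges_eq, hp, List.map_map]
      have := hnd.map hD.injective
      rwa [List.map_map] at this
    · rw [Walk.tails_eq, (p.backward_spec hback).2, hlen]
      exact hnd
  exact ⟨v, p, hcyc, fun e => ((cyclic_backward hcyc hback).2.2 e).symm⟩

theorem cyclesIn_eq_image [DecidableEq V] (hD : G.IsOrientation S D) :
    G.cyclesIn S = (mapCycles fun v => G.tail (D v)).image fun Z => Z.image fun u => (D u).1 := by
  classical
  ext C
  rw [cyclesIn, Finset.mem_filter, Finset.mem_powerset, Finset.mem_image]
  constructor
  · rintro ⟨hCS, v, p, hp, hC⟩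
    obtain ⟨h1, h2⟩ := hD.cyclic_spec hp fun e he => hCS ((hC e).2 he)
    refine ⟨_, mem_mapCycles.2 ⟨v, h1, rfl⟩, ?_⟩
    ext e
    rw [hC, h2]
  · rintro ⟨Z, hZ, rfl⟩
    obtain ⟨v, hv, rfl⟩ := mem_mapCycles.1 hZ
    refine ⟨?_, hD.isCycle_image_forwardOrbit hv⟩
    rw [← hD.image_eq]
    exact Finset.image_subset_image (Finset.subset_univ _)

theorem image_injective (hD : G.IsOrientation S D) :
    Function.Injective fun Z : Finset V => Z.image fun u => (D u).1 :=
  Finset.image_injective hD.injective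

theorem card_cyclesIn [DecidableEq V] (hD : G.IsOrientation S D) :
    (G.cyclesIn S).card = (mapCycles fun v => G.tail (D v)).card := by
  rw [hD.cyclesIn_eq_image, Finset.card_image_of_injective _ hD.image_injective]

variable {F : V → Type*} [∀ v, AddCommGroup (F v)] [∀ v, Module ℂ (F v)] {Φ : G.Connection F}
  {frame : ∀ v, F v ≃ₗ[ℂ] (Fin 2 → ℂ)}

/-- The walk follows the orientation throughout or opposes it throughout; the two matrices are
adjugate and so have equal trace. -/
theorem trace_walkTransport [DecidableEq V] (hΦ : Φ.IsSL2 frame) (hD : G.IsOrientation S D) {v : V}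
    {p : G.Walk v v} (hp : p.IsCyclic) (hS : ∀ e ∈ p.edges, e ∈ S) :
    LinearMap.trace ℂ (F v) (Φ.walkTransport p).toLinearMap =
      (orbitProd (fun v => G.tail (D v)) (fun v => Φ.dartMatrix frame (D v)) v).trace := by
  rw [← Connection.trace_walkMatrix Φ frame, orbitProd]
  rcases hD.forward_or_backward p hS hp.2.1 with h | h
  · rw [(cyclic_forward hp h).2.1, Connection.walkMatrix_of_forward p h]
  · rw [(cyclic_backward hp h).2.1, Connection.walkMatrix_of_backward hΦ p h,
      Matrix.trace_adjugate_fin_two]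

theorem half_cycleTrace [DecidableEq V] (hΦ : Φ.IsSL2 frame) (hD : G.IsOrientation S D)
    {Z : Finset V} (hZ : Z ∈ mapCycles fun v => G.tail (D v)) :
    (1 / 2 : ℂ) * Φ.cycleTrace (Z.image fun u => (D u).1) =
      halfTrace (fun v => G.tail (D v)) (fun v => Φ.dartMatrix frame (D v)) Z := by
  obtain ⟨x, hx, rfl⟩ := mem_mapCycles.1 hZ
  have hC := hD.isCycle_image_forwardOrbit hx
  have hsub : ((forwardOrbit (fun v => G.tail (D v)) x).image fun u => (D u).1) ⊆ S := by
    rw [← hD.image_eq]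
    exact Finset.image_subset_image (Finset.subset_univ _)
  rw [Connection.cycleTrace, dif_pos hC]
  obtain ⟨hp, hedges⟩ := hC.choose_spec.choose_spec
  have hS : ∀ e ∈ hC.choose_spec.choose.edges, e ∈ S := fun e he => hsub ((hedges e).2 he)
  obtain ⟨hv, himg⟩ := hD.cyclic_spec hp hS
  -- The walk selected by `cycleTrace` may start elsewhere, but distinct vertices choose distinct
  -- edges, so its edge set determines the orbit.
  have horb : forwardOrbit (fun v => G.tail (D v)) x =
      forwardOrbit (fun v => G.tail (D v)) hC.choose := by
    apply hD.image_injective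
    ext e
    rw [← himg, ← hedges]
  rw [hD.trace_walkTransport hΦ hp hS]
  exact (halfTrace_forwardOrbit _ hv).symm.trans (congrArg _ horb.symm)

theorem prod_mapCycles_eq_prod_cyclesIn [DecidableEq V] (hΦ : Φ.IsSL2 frame)
    (hD : G.IsOrientation S D) :
    ∏ Z ∈ mapCycles fun v => G.tail (D v), (1 - halfTrace (fun v => G.tail (D v))
        (fun v => Φ.dartMatrix frame (D v)) Z) =
      ∏ C ∈ G.cyclesIn S, (1 - (1 / 2 : ℂ) * Φ.cycleTrace C) := by
  rw [hD.cyclesIn_eq_image, Finset.prod_image fun a _ b _ h => hD.image_injective h]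
  refine Finset.prod_congr rfl fun Z hZ => ?_
  rw [hD.half_cycleTrace hΦ hZ]

end IsOrientation

end MultiGraph

/-! ### The Laplacian: self-duality and expansion over choices of edges -/

/-- Taking the adjugate is additive on `2 × 2` matrices. -/
def Matrix.adjugateFinTwoHom {R : Type*} [CommRing R] :
    Matrix (Fin 2) (Fin 2) R →+ Matrix (Fin 2) (Fin 2) R where
  toFun := Matrix.adjugate
  map_zero' := Matrix.adjugate_zero
  map_add' A B := by
    ext i j
    fin_cases i <;> fin_cases j <;> simp [Matrix.adjugate_fin_two, add_comm]

theorem Matrix.adjugateFinTwoHom_apply {R : Type*} [CommRing R] (A : Matrix (Fin 2) (Fin 2) R) :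
    Matrix.adjugateFinTwoHom A = A.adjugate := rfl

section

variable {V : Type*} [DecidableEq V] {F : V → Type*}
  [∀ v, AddCommGroup (F v)] [∀ v, Module ℂ (F v)] (frame : ∀ v, F v ≃ₗ[ℂ] (Fin 2 → ℂ))

theorem blockMatrix_sum_apply {ι : Type*} (s : Finset ι)
    (T : ι → (∀ v, F v) →ₗ[ℂ] (∀ v, F v)) (i j : V) :
    blockMatrix frame (∑ d ∈ s, T d) i j = ∑ d ∈ s, blockMatrix frame (T d) i j := by
  ext a b
  simp [blockMatrix, LinearMap.toMatrix'_apply, Matrix.sum_apply]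

end

namespace MultiGraph

namespace Connection

variable {V E : Type*} {G : MultiGraph V E}
  {F : V → Type*} [∀ v, AddCommGroup (F v)] [∀ v, Module ℂ (F v)] (Φ : G.Connection F)
  (frame : ∀ v, F v ≃ₗ[ℂ] (Fin 2 → ℂ))

theorem blockMatrix_single_apply [DecidableEq V] (d : E × Bool) (i j : V) :
    blockMatrix frame (LinearMap.single ℂ F (G.head d) ∘ₗ
      (LinearMap.proj (G.head d) - (Φ.transport d).toLinearMap ∘ₗ LinearMap.proj (G.tail d))) i j =
    if G.head d = i then
      (if i = j then 1 else 0) - (if G.tail d = j then Φ.dartMatrix frame d else 0) else 0 := by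
  rw [blockMatrix, Matrix.of_apply]
  by_cases hi : G.head d = i
  · subst hi
    rw [if_pos rfl]
    have h1 : LinearMap.toMatrix' ((frame (G.head d)).toLinearMap ∘ₗ LinearMap.proj (G.head d) ∘ₗ
        LinearMap.single ℂ F j ∘ₗ (frame j).symm.toLinearMap) =
        if G.head d = j then 1 else 0 := by
      split_ifs with h
      · subst h
        rw [← LinearMap.toMatrix'_id]
        congr 1
        ext x
        simp
      · rw [← map_zero LinearMap.toMatrix']
        congr 1
        ext x
        simp [Pi.single_eq_of_ne h]
    have h2 : LinearMap.toMatrix' ((frame (G.head d)).toLinearMap ∘ₗ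
        (Φ.transport d).toLinearMap ∘ₗ LinearMap.proj (G.tail d) ∘ₗ
        LinearMap.single ℂ F j ∘ₗ (frame j).symm.toLinearMap) =
        if G.tail d = j then Φ.dartMatrix frame d else 0 := by
      split_ifs with h
      · subst h
        rw [dartMatrix]
        congr 1
        ext x
        simp
      · rw [← map_zero LinearMap.toMatrix']
        congr 1
        ext x
        simp [Pi.single_eq_of_ne h]
    rw [← h1, ← h2, ← map_sub]
    congr 1
    ext x
    simp
  · rw [if_neg hi, ← map_zero LinearMap.toMatrix']
    congr 1
    ext x
    simp [Pi.single_eq_of_ne (Ne.symm hi)]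

theorem blockMatrix_laplacian [DecidableEq V] [Fintype E] :
    blockMatrix frame Φ.laplacian = Matrix.of fun i =>
      ∑ d ∈ Finset.univ.filter (fun d : E × Bool => G.head d = i), fun j =>
        (if i = j then 1 else 0) - (if G.tail d = j then Φ.dartMatrix frame d else 0) := by
  ext1 i j
  rw [laplacian, blockMatrix_sum_apply, Matrix.of_apply, Finset.sum_apply, Finset.sum_filter]
  exact Finset.sum_congr rfl fun d _ => Φ.blockMatrix_single_apply frame d i j

variable {Φ frame}

theorem isSelfDual_laplacian [DecidableEq V] [Fintype E] (hΦ : Φ.IsSL2 frame) :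
    IsSelfDual (blockMatrix frame Φ.laplacian) := by
  have key : ∀ i j, blockMatrix frame Φ.laplacian i j =
      (∑ d : E × Bool, if G.head d = i ∧ i = j then 1 else 0) -
        ∑ d : E × Bool, if G.head d = i ∧ G.tail d = j then Φ.dartMatrix frame d else 0 := by
    intro i j
    rw [laplacian, blockMatrix_sum_apply, ← Finset.sum_sub_distrib]
    refine Finset.sum_congr rfl fun d _ => ?_
    rw [blockMatrix_single_apply, ite_and, ite_and]
    split_ifs <;> simp
  intro i j
  rw [key, key, ← Matrix.adjugateFinTwoHom_apply, map_sub, map_sum, map_sum]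
  congr 1
  · refine Finset.sum_congr rfl fun d _ => ?_
    by_cases h : i = j
    · subst h
      split_ifs <;> simp [Matrix.adjugateFinTwoHom_apply]
    · simp [h, Ne.symm h]
  -- Reversing edges exchanges the entries `(i, j)` and `(j, i)` and replaces each transport by its
  -- adjugate.
  · refine Finset.sum_equiv ⟨rev, rev, rev_rev, rev_rev⟩ (by simp) fun d _ => ?_
    change _ = Matrix.adjugateFinTwoHom (if G.head (rev d) = j ∧ G.tail (rev d) = i then
      Φ.dartMatrix frame (rev d) else 0)
    rw [head_rev, tail_rev, apply_ite Matrix.adjugateFinTwoHom, map_zero,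
      Matrix.adjugateFinTwoHom_apply, ← dartMatrix_rev hΦ, rev_rev]
    simp only [and_comm]

/-- An edge chosen at both its ends makes a 2-cycle traversing it back and forth; the monodromy is
`1`, so the factor is `1 - tr(1)/2 = 0`. -/
theorem prod_mapCycles_eq_zero [Fintype V] [DecidableEq V]
    {D : V → E × Bool} (hD : ∀ v, G.head (D v) = v)
    (hinj : ¬ Function.Injective fun v => (D v).1) :
    ∏ Z ∈ mapCycles fun v => G.tail (D v), (1 - halfTrace (fun v => G.tail (D v))
        (fun v => Φ.dartMatrix frame (D v)) Z) = 0 := by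
  obtain ⟨u, v, huv, hne⟩ : ∃ u v, (D u).1 = (D v).1 ∧ u ≠ v := by
    simpa [Function.Injective] using hinj
  have h : D u = rev (D v) := by
    rcases eq_or_eq_rev huv with h | h
    · exact absurd (by rw [← hD u, h, hD v]) hne
    · exact h
  set f : V → V := fun v => G.tail (D v) with hf
  have h1 : f u = v := by simp only [hf, h, tail_rev, hD]
  have h2 : f v = u := by rw [← hD u, h, head_rev]
  have hper : f^[2] u = u := by
    rw [Function.iterate_succ_apply, Function.iterate_one, h1, h2]
  have hu : u ∈ Function.periodicPts f := ⟨2, two_pos, hper⟩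
  have hmin : Function.minimalPeriod f u = 2 :=
    minimalPeriod_eq_of_forall_ne two_pos hper fun m hm hm2 => by
      obtain rfl : m = 1 := by omega
      rw [Function.iterate_one, h1]
      exact hne.symm
  refine Finset.prod_eq_zero (mem_mapCycles.2 ⟨u, hu, rfl⟩) ?_
  rw [halfTrace_forwardOrbit _ hu, orbitProd, hmin, List.range_succ, List.range_one]
  simp [h1, h, dartMatrix_rev_mul]

theorem qdet_laplacian [Fintype V] [DecidableEq V] [Fintype E] (hΦ : Φ.IsSL2 frame) :
    qdet (blockMatrix frame Φ.laplacian) =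
      ∑ S ∈ G.crsfs, ∏ C ∈ G.cyclesIn S, (2 - Φ.cycleTrace C) := by
  classical
  rw [blockMatrix_laplacian, qdet_sum_rows]
  let w : (V → E × Bool) → ℂ := fun D => ∏ Z ∈ mapCycles fun v => G.tail (D v),
    (1 - halfTrace (fun v => G.tail (D v)) (fun v => Φ.dartMatrix frame (D v)) Z)
  have hw : ∀ D : V → E × Bool, qdet (Matrix.of fun i => fun j =>
      (if i = j then 1 else 0) - (if G.tail (D i) = j then Φ.dartMatrix frame (D i) else 0)) =
      w D := fun D => qdet_stepMatrix (fun v => G.tail (D v)) fun v => Φ.dartMatrix frame (D v)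
  rw [Finset.sum_congr rfl fun D _ => hw D]
  let edges : (V → E × Bool) → Finset E := fun D => Finset.univ.image fun v => (D v).1
  have hor : ∀ D, (∀ v, G.head (D v) = v) → (Function.Injective fun v => (D v).1) →
      G.IsOrientation (edges D) D := fun D h1 h2 => ⟨h1, h2, rfl⟩
  have hsub : ∑ D ∈ Finset.univ.filter (fun D : V → E × Bool => G.IsOrientation (edges D) D), w D =
      ∑ D ∈ Fintype.piFinset fun i => Finset.univ.filter (fun d : E × Bool => G.head d = i),
        w D := by
    apply Finset.sum_subset
    · intro D hD
      rw [Fintype.mem_piFinset]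
      exact fun v => Finset.mem_filter.2 ⟨Finset.mem_univ _, (Finset.mem_filter.1 hD).2.head_eq v⟩
    · intro D hD hD'
      rw [Fintype.mem_piFinset] at hD
      have hD := fun v => (Finset.mem_filter.1 (hD v)).2
      exact prod_mapCycles_eq_zero hD fun hinj =>
        hD' (Finset.mem_filter.2 ⟨Finset.mem_univ _, hor D hD hinj⟩)
  rw [← hsub, ← Finset.sum_fiberwise_of_maps_to (g := edges) (t := G.crsfs) fun D hD =>
    Finset.mem_filter.2 ⟨Finset.mem_univ _, (Finset.mem_filter.1 hD).2.isCRSF⟩]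
  refine Finset.sum_congr rfl fun S hS => ?_
  obtain ⟨D₀, hD₀⟩ := IsCRSF.exists_isOrientation (Finset.mem_filter.1 hS).2
  have hfib : ((Finset.univ.filter fun D : V → E × Bool => G.IsOrientation (edges D) D).filter
      fun D => edges D = S) = Finset.univ.filter (G.IsOrientation S) := by
    ext D
    simp only [Finset.mem_filter, Finset.mem_univ, true_and]
    constructor
    · rintro ⟨h, rfl⟩
      exact h
    · intro h
      have := h.image_eq
      exact ⟨hor D h.head_eq h.injective, this⟩
  -- The weight depends only on `S`, so the fibre contributes it `2 ^ k` times, `k` being the number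
  -- of cycles; one factor `2` goes to each cycle.
  rw [hfib, Finset.sum_congr rfl fun D hD =>
    (Finset.mem_filter.1 hD).2.prod_mapCycles_eq_prod_cyclesIn hΦ, Finset.sum_const,
    hD₀.card_eq, ← hD₀.card_cyclesIn, nsmul_eq_mul, Nat.cast_pow, ← Finset.prod_const,
    ← Finset.prod_mul_distrib]
  refine Finset.prod_congr rfl fun C _ => ?_
  push_cast
  ring

end Connection

end MultiGraph

/-- For a `ℂ²`-bundle with `SL₂(ℂ)` connection on a finite connected graph, the Laplacian is
self-dual and its `Q`-determinant is the sum over cycle-rooted spanning forests of the product over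
their cycles of `2 - tr (monodromy)`. -/
theorem mainTheorem1 {V E : Type*} [Fintype V] [DecidableEq V] [Fintype E]
    (G : MultiGraph V E) (hG : G.Connected)
    (F : V → Type*) [∀ v, AddCommGroup (F v)] [∀ v, Module ℂ (F v)]
    (frame : ∀ v, F v ≃ₗ[ℂ] (Fin 2 → ℂ))
    (Φ : G.Connection F) (hΦ : Φ.IsSL2 frame) :
    IsSelfDual (blockMatrix frame Φ.laplacian) ∧
    qdet (blockMatrix frame Φ.laplacian) =
      ∑ S ∈ G.crsfs, ∏ C ∈ G.cyclesIn S, (2 - Φ.cycleTrace C) :=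
  ⟨MultiGraph.Connection.isSelfDual_laplacian hΦ, MultiGraph.Connection.qdet_laplacian hΦ⟩
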